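/- **Conventions.** Let $P$ be a nontrivial partial combinatory algebra, with pairing $\mathbf p$, Church numerals $0,1$ and codes $\langle n_1,\dots,n_k\rangle\in P$ of finite sequences of elements of $P$. For $A\subseteq P$ let $!A$ be the set of codes of finite sequences with all components in $A$, and write $m\preceq n$ if every component of $m$ is a component of $n$. Let $\Sigma$ be the set of pairs $(A_0,A_1)$ with $A_1\subseteq P$ and $A_0\subseteq\,!A_1$ upwards closed in $!A_1$ for $\preceq$. For a set $X$, put $\varphi\le\psi$ in $\Sigma^X$ if there is a single $r\in P$ such that for all $x\in X$: $n\in\,!\varphi(x)_1$ implies that $r\cdot n$ is defined and lies in $!\psi(x)_1$, and $n\in\varphi(x)_0$ implies $r\cdot n\in\psi(x)_0$. This is a tripos, in which the following describe conjunction and existential quantification: * $(A\wedge B)_1=\{\mathbf p0a: a\in A_1\}\cup\{\mathbf p1b: b\in B_1\}$, and $(A\wedge B)_0$ consists of the codes of sequences of elements of $(A\wedge B)_1$ that contain all $\mathbf p0a_i$ for some $\langle a_1,\dots,a_k\rangle\in A_0$ and all $\mathbf p1b_j$ for some $\langle b_1,\dots,b_l\rangle\in B_0$; * $(\exists_j\varphi_j)_1=\bigcup_j\,!(\varphi_j)_1$,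 and $(\exists_j\varphi_j)_0$ is the upward closure in $!(\exists_j\varphi_j)_1$ of $\{\langle n\rangle:\exists j,\ n\in(\varphi_j)_0\}$. The Herbrand topos $\mathsf{HT}[P]$ is the associated topos: its objects are sets $X$ with a symmetric and transitive $\Sigma$-valued relation $[\![x=x']\!]$, and its morphisms are $\Sigma$-valued functional relations up to mutual entailment. The functor $\nabla:\mathbf{Sets}\to\mathsf{HT}[P]$ sends a set $X$ to the object $X$ with $[\![x=x']\!]=(!P,P)$ if $x=x'$ and $(\emptyset,P)$ otherwise, and sends a function $f:X\to Y$ to the morphism represented by $F(x,y)=[\![x=x]\!]\wedge[\![f(x)=y]\!]$. **Theorem.** 1. $\nabla$ preserves the structure of a locally cartesian closed pretopos: it sends finite limit cones to limit cones, finite coproduct cocones to coproduct cocones, regular epimorphisms to regular epimorphisms, internal equivalence relations $R\rightrightarrows X$ to internal equivalence relations, quotients (coequalizers) of equivalence relations to quotients of equivalence relations, and dependent products $\prod_f g$ (for $S\xrightarrow{g}B\xrightarrow{f}A$) together with their evaluation maps $f^*\prod_f g\to S$ to dependent products with their evaluation maps. 2. $\nabla$ reflects this structure: if $\nabla$ sends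 a finite diagram with a cone over it (a finite family with a cocone under it, a morphism, a parallel pair, a fork-shaped diagram $R\rightrightarrows X\to Q$, or a diagram of the shape of a dependent product with its evaluation map) to a limit cone (respectively a coproduct cocone, a regular epimorphism, an equivalence relation, a quotient of an equivalence relation, a dependent product), then the original already was one in $\mathbf{Sets}$. 3. In particular, $\nabla$ preserves and reflects validity of first-order formulas: for every many-sorted first-order signature, every set-valued structure $M$ for it (sorts may be empty), and every first-order formula $\varphi$ in a finite context of variables, $\varphi$ is true in $M$ in the sense of Tarski under all assignments if and only if $\varphi$ is valid in the structure $\nabla M$ in $\mathsf{HT}[P]$, i.e. its interpretation as a subobject of the product of the sorts of its context is the maximal subobject. 4. For example $\nabla 2=2$: $\nabla 1$ is terminal in $\mathsf{HT}[P]$, and $\nabla$ of the two inclusions $1\to 2$ exhibits $\nabla 2$ as the coproduct of $\nabla 1$ with itself. -/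

import Mathlib

open CategoryTheory CategoryTheory.Limits

set_option linter.unusedSectionVars false

universe w u v₁ v₂ u₁ u₂

noncomputable section

namespace Herbrand

/-! ### Partial combinatory algebras -/

/-- A set with a partial binary application. -/
class PartialApplicative (P : Type u) where
  app : P → P → Part P


/-- Application of possibly undefined expressions (defined iff both sides and the result are). -/
def papp {P : Type u} [PartialApplicative P] (x y : Part P) : Part P :=
  x.bind fun a => y.bind fun b => PartialApplicative.app a b

/-- A partial combinatory algebra; equality in `Part P` is Kleene equality. -/
class PCA (P : Type u) extends PartialApplicative P where
  k : P
  s : P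
  k_app : ∀ a b : P, papp (app k a) (Part.some b) = Part.some a
  s_dom : ∀ a b : P, (papp (app s a) (Part.some b)).Dom
  s_app : ∀ a b c : P, papp (papp (app s a) (Part.some b)) (Part.some c) =
    papp (app a c) (app b c)

section Combinators

variable {P : Type u} [PCA P]

/-- Application `a · b`. -/
def app (a b : P) : Part P := PartialApplicative.app a b

@[simp] theorem papp_some (a b : P) : papp (Part.some a) (Part.some b) = app a b := by
  simp [papp, app]

@[simp] theorem papp_none_left (x : Part P) : papp Part.none x = Part.none := by
  simp [papp]

theorem k_dom (a : P) : (app PCA.k a).Dom := by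
  have h := PCA.k_app a a
  by_contra hn
  have h' : (PartialApplicative.app PCA.k a : Part P) = Part.none := Part.eq_none_iff'.2 hn
  rw [h', papp_none_left] at h
  exact Part.some_ne_none _ h.symm

/-- The element `k · a`. -/
def k1 (a : P) : P := (app PCA.k a).get (k_dom a)

theorem app_k (a : P) : app PCA.k a = Part.some (k1 a) := (Part.some_get _).symm

@[simp] theorem app_k1 (a b : P) : app (k1 a) b = Part.some a := by
  have h := PCA.k_app a b
  change papp (app PCA.k a) _ = _ at h
  rwa [app_k, papp_some] at h

/-- The element `s · a · b`. -/
def s2 (a b : P) : P := (papp (app PCA.s a) (Part.some b)).get (PCA.s_dom a b)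

theorem papp_s (a b : P) : papp (app PCA.s a) (Part.some b) = Part.some (s2 a b) :=
  (Part.some_get _).symm

@[simp] theorem app_s2 (a b c : P) : app (s2 a b) c = papp (app a c) (app b c) := by
  have h := PCA.s_app a b c
  change papp (papp (app PCA.s a) _) _ = papp (app a c) (app b c) at h
  rwa [papp_s, papp_some] at h

/-- The identity combinator `s k k`. -/
def idc : P := s2 PCA.k PCA.k

@[simp] theorem app_idc (a : P) : app (idc : P) a = Part.some a := by
  simp [idc, app_k]

/-- The Church numeral `0`, i.e. `λ f x. x`. -/
def church0 : P := k1 idc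

/-- The Church numeral `1`, i.e. `λ f x. f x`. -/
def church1 : P := s2 (s2 (k1 PCA.s) PCA.k) (k1 idc)

/-- The pairing `𝐩 a b`, where `𝐩 = λ x y z. z x y`. -/
def pair (a b : P) : P := s2 (s2 idc (k1 a)) (k1 b)

@[simp] theorem app_church0 (f : P) : app (church0 : P) f = Part.some idc := by
  simp [church0]

theorem app_church1 (f : P) : app (church1 : P) f = Part.some (s2 (k1 f) idc) := by
  have h : papp (papp (Part.some PCA.s) (Part.some (k1 f))) (Part.some idc)
      = Part.some (s2 (k1 f) idc) := by rw [papp_some, papp_s]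
  simpa [church1, app_k] using h

theorem app_pair (a b c : P) : app (pair a b) c = papp (app c a) (Part.some b) := by
  simp [pair]

/-! Polynomials over `P` and bracket abstraction. -/

/-- Formal polynomials over `P`, with variables indexed by position. -/
inductive Tm (P : Type u) : Type u
  | var (n : ℕ) : Tm P
  | const (a : P) : Tm P
  | app (t t' : Tm P) : Tm P

/-- Push a value in front of an environment. -/
def push (a : P) (ρ : ℕ → P) : ℕ → P
  | 0 => a
  | n + 1 => ρ n

/-- Evaluation of a polynomial. -/
def Tm.eval (ρ : ℕ → P) : Tm P → Part P
  | .var n => Part.some (ρ n)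
  | .const a => Part.some a
  | .app t t' => papp (t.eval ρ) (t'.eval ρ)

/-- Bracket abstraction of the variable `0`. -/
def Tm.lam : Tm P → Tm P
  | .var 0 => .const idc
  | .var (n + 1) => .app (.const PCA.k) (.var n)
  | .const a => .app (.const PCA.k) (.const a)
  | .app t t' => .app (.app (.const PCA.s) t.lam) t'.lam

/-- The value of a bracket abstraction. -/
def Tm.lamVal (ρ : ℕ → P) : Tm P → P
  | .var 0 => idc
  | .var (n + 1) => k1 (ρ n)
  | .const a => k1 a
  | .app t t' => s2 (t.lamVal ρ) (t'.lamVal ρ)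

theorem Tm.eval_lam (ρ : ℕ → P) (t : Tm P) : t.lam.eval ρ = Part.some (t.lamVal ρ) := by
  induction t with
  | var n => cases n <;> simp [lam, eval, lamVal, app_k]
  | const a => simp [lam, eval, lamVal, app_k]
  | app t t' h h' => simp [lam, eval, lamVal, h, h', papp_s]

theorem Tm.app_lamVal (ρ : ℕ → P) (t : Tm P) (a : P) :
    Herbrand.app (t.lamVal ρ) a = t.eval (push a ρ) := by
  induction t with
  | var n => cases n <;> simp [lamVal, eval, push]
  | const b => simp [lamVal, eval]
  | app t t' h h' => simp [lamVal, eval, h, h']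

/-! Codes of finite sequences. -/

/-- The code of a finite sequence: `⟨⟩ = 𝐩 0 0` and `⟨a, a₁, …⟩ = 𝐩 1 (𝐩 a ⟨a₁, …⟩)`. -/
def enc : List P → P
  | [] => pair church0 church0
  | a :: l => pair church1 (pair a (enc l))

theorem app_pair_k (a b : P) : app (pair a b) PCA.k = Part.some a := by
  simp [app_pair, app_k]

theorem app_pair_ki (a b : P) : app (pair a b) (k1 idc) = Part.some b := by
  simp [app_pair]

theorem pair_inj {a b a' b' : P} (h : pair a b = pair a' b') : a = a' ∧ b = b' := by
  refine ⟨Part.some_injective ?_, Part.some_injective ?_⟩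
  · rw [← app_pair_k a b, h, app_pair_k]
  · rw [← app_pair_ki a b, h, app_pair_ki]

theorem church_ne [Nontrivial P] : (church0 : P) ≠ church1 := by
  intro h
  obtain ⟨a, b, hab⟩ := exists_pair_ne P
  have h0 : papp (app (church0 : P) (k1 a)) (Part.some b) = Part.some b := by simp
  have h1 : papp (app (church1 : P) (k1 a)) (Part.some b) = Part.some a := by
    simp [app_church1]
  rw [h, h1] at h0
  exact hab (Part.some_injective h0)

theorem enc_injective [Nontrivial P] : Function.Injective (enc : List P → P) := by
  intro l
  induction l with
  | nil =>
    intro l' h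
    cases l' with
    | nil => rfl
    | cons a l' => exact absurd (pair_inj h).1 church_ne
  | cons a l ih =>
    intro l' h
    cases l' with
    | nil => exact absurd (pair_inj h).1.symm church_ne
    | cons a' l' =>
      obtain ⟨h1, h2⟩ := pair_inj (pair_inj h).2
      rw [h1, ih h2]

/-- Recursion over codes of sequences, with a parameter `c`. -/
theorem exists_listRec (z f : P) : ∃ R : P, ∀ c : P, ∃ Rc : P, app R c = Part.some Rc ∧
    app Rc (enc []) = app z c ∧
    ∀ (a : P) (l : List P), app Rc (enc (a :: l)) =
      papp (papp (app f c) (Part.some a)) (app Rc (enc l)) := by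
  let v (n : ℕ) : Tm P := .var n
  let fst (t : Tm P) : Tm P := .app t (.const PCA.k)
  let snd (t : Tm P) : Tm P := .app t (.const (k1 idc))
  let A : Tm P := .lam (.app (.app (.app (.const f) (v 2)) (fst (snd (v 1))))
    (.app (.app (.app (v 3) (v 3)) (v 2)) (snd (snd (v 1)))))
  let B : Tm P := .lam (.app (.const z) (v 2))
  let body : Tm P := .app (.app (.app (fst (v 0)) (.app (.const PCA.k) A)) B) (.const idc)
  let W : P := body.lam.lam.lamVal (fun _ => idc)
  have hW : app W W = Part.some (body.lam.lamVal (push W fun _ => idc)) := by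
    rw [Tm.app_lamVal, Tm.eval_lam]
  refine ⟨body.lam.lamVal (push W fun _ => idc), fun c =>
    ⟨body.lamVal (push c (push W fun _ => idc)), ?_, ?_, ?_⟩⟩
  · rw [Tm.app_lamVal, Tm.eval_lam]
  · rw [Tm.app_lamVal]
    simp [body, fst, v, A, B, Tm.eval, Tm.eval_lam, push, enc, app_pair_k, app_k,
      Tm.app_lamVal]
  · intro a l
    have hWW : app W W = Part.some (body.lam.lamVal (push W fun _ => idc)) := hW
    have hWc : app (body.lam.lamVal (push W fun _ => idc)) c =
        Part.some (body.lamVal (push c (push W fun _ => idc))) := by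
      rw [Tm.app_lamVal, Tm.eval_lam]
    generalize hRc : body.lamVal (push c (push W fun _ => idc)) = Rc at hWc ⊢
    generalize body.lam.lamVal (push W fun _ => idc) = R at hWW hWc
    conv_lhs => rw [← hRc, Tm.app_lamVal]
    simp [body, fst, snd, v, A, B, Tm.eval, Tm.eval_lam, push, enc, app_pair_k, app_pair_ki,
      app_k, app_church1, Tm.app_lamVal, hWW, hWc]

/-- Pairing is represented. -/
theorem exists_pair : ∃ f : P, ∀ a b : P,
    papp (app f a) (Part.some b) = Part.some (pair a b) := by
  let t : Tm P := .lam (.app (.app (.var 0) (.var 2)) (.var 1))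
  refine ⟨t.lam.lamVal (fun _ => idc), fun a b => ?_⟩
  rw [Tm.app_lamVal, Tm.eval_lam, papp_some, Tm.app_lamVal, Tm.eval_lam]
  rfl

theorem exists_cons : ∃ f : P, ∀ c a b : P,
    papp (papp (app f c) (Part.some a)) (Part.some b) = Part.some (pair church1 (pair a b)) := by
  obtain ⟨p, hp⟩ := exists_pair (P := P)
  let t : Tm P := .app (.app (.const p) (.const church1))
    (.app (.app (.const p) (.var 1)) (.var 0))
  refine ⟨t.lam.lam.lamVal (fun _ => idc), fun c a b => ?_⟩
  simp [Tm.app_lamVal, Tm.eval_lam, t, Tm.eval, push, hp]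

/-- Concatenation is represented (with the arguments in reverse order). -/
theorem exists_append : ∃ R : P, ∀ m : List P, ∃ Rm : P, app R (enc m) = Part.some Rm ∧
    ∀ l : List P, app Rm (enc l) = Part.some (enc (l ++ m)) := by
  obtain ⟨f, hf⟩ := exists_cons (P := P)
  obtain ⟨R, hR⟩ := exists_listRec (idc : P) f
  refine ⟨R, fun m => ?_⟩
  obtain ⟨Rm, h1, h2, h3⟩ := hR (enc m)
  refine ⟨Rm, h1, fun l => ?_⟩
  induction l with
  | nil => simpa using h2
  | cons a l ih => rw [h3, ih, hf]; rfl

/-- Concatenating the values of a represented function over a sequence is represented,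
uniformly in a parameter `c`. -/
theorem exists_flatMap (r : P) : ∃ R : P, ∀ c : P, ∃ Rc : P, app R c = Part.some Rc ∧
    ∀ (l : List P) (g : P → List P),
      (∀ a ∈ l, papp (app r c) (Part.some a) = Part.some (enc (g a))) →
      app Rc (enc l) = Part.some (enc (l.flatMap g)) := by
  obtain ⟨ap, hap⟩ := exists_append (P := P)
  let tf : Tm P := .app (.app (.const ap) (.var 0)) (.app (.app (.const r) (.var 2)) (.var 1))
  obtain ⟨R, hR⟩ := exists_listRec (k1 (enc []) : P) (tf.lam.lam.lamVal (fun _ => idc))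
  refine ⟨R, fun c => ?_⟩
  obtain ⟨Rc, h1, h2, h3⟩ := hR c
  refine ⟨Rc, h1, fun l g => ?_⟩
  induction l with
  | nil => intro _; simpa using h2
  | cons a l ih =>
    intro h
    rw [h3, ih fun b hb => h b (List.mem_cons_of_mem _ hb)]
    have ha := h a List.mem_cons_self
    obtain ⟨Rm, h4, h5⟩ := hap (l.flatMap g)
    simp [Tm.app_lamVal, Tm.eval_lam, tf, Tm.eval, push, ha, h4, h5]

end Combinators

/-! ### The Herbrand tripos -/

section Tripos

variable {P : Type u} [PCA P]

/-- `!A`: the codes of finite sequences all whose elements belong to `A`. -/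
def bang (A : Set P) : Set P := {n | ∃ l : List P, (∀ a ∈ l, a ∈ A) ∧ n = enc l}

/-- The preorder on codes: every component of `m` is a component of `n`. -/
def seqLE (m n : P) : Prop := ∃ l l' : List P, m = enc l ∧ n = enc l' ∧ l ⊆ l'

/-- `U` is upwards closed in `!A`. -/
def UpClosed (A U : Set P) : Prop := ∀ m ∈ U, ∀ n ∈ bang A, seqLE m n → n ∈ U

/-- `A & B = {𝐩 0 a} ∪ {𝐩 1 b}`. -/
def amp (A B : Set P) : Set P := {x | (∃ a ∈ A, x = pair church0 a) ∨ ∃ b ∈ B, x = pair church1 b}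

/-- The truth values `(A₀, A₁)` of the Herbrand tripos. -/
structure Sig (P : Type u) [PCA P] where
  act : Set P
  pot : Set P
  act_sub : act ⊆ bang pot
  up : UpClosed pot act

/-- The order on `Sig P`-valued predicates: one realizer works uniformly in the index. -/
def Entails {I : Type w} (φ ψ : I → Sig P) : Prop :=
  ∃ r : P, ∀ i, (∀ n ∈ bang (φ i).pot, ∃ m ∈ app r n, m ∈ bang (ψ i).pot) ∧
    (∀ n ∈ (φ i).act, ∃ m ∈ app r n, m ∈ (ψ i).act)

variable [Nontrivial P]

theorem enc_mem_of_up {A U : Set P} (h : UpClosed A U) {l l' : List P} (hl : enc l ∈ U)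
    (hl' : ∀ a ∈ l', a ∈ A) (hs : l ⊆ l') : enc l' ∈ U :=
  h _ hl _ ⟨l', hl', rfl⟩ ⟨l, l', rfl, rfl, hs⟩

theorem upClosed_of {A U : Set P} (h : ∀ l l' : List P, enc l ∈ U → (∀ a ∈ l', a ∈ A) → l ⊆ l' →
    enc l' ∈ U) : UpClosed A U := by
  rintro m hm n ⟨l₁, hl₁, rfl⟩ ⟨l, l', rfl, h2, hs⟩
  obtain rfl := enc_injective h2
  exact h l l₁ hm hl₁ hs

theorem mem_bang {A : Set P} {l : List P} : enc l ∈ bang A ↔ ∀ a ∈ l, a ∈ A :=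
  ⟨fun ⟨_, h, e⟩ => enc_injective e ▸ h, fun h => ⟨l, h, rfl⟩⟩

namespace Sig

/-- Conjunction: `!(A₁ & B₁)` is identified with the pairs of elements of `!A₁` and `!B₁`, and a
sequence is actual iff both of its parts are. -/
def and (A B : Sig P) : Sig P where
  act := {n | ∃ l : List P, n = enc l ∧ (∀ x ∈ l, x ∈ amp A.pot B.pot) ∧
    (∃ a : List P, enc a ∈ A.act ∧ ∀ x ∈ a, pair church0 x ∈ l) ∧
    (∃ b : List P, enc b ∈ B.act ∧ ∀ x ∈ b, pair church1 x ∈ l)}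
  pot := amp A.pot B.pot
  act_sub := by
    rintro n ⟨l, rfl, h, -⟩
    exact ⟨l, h, rfl⟩
  up := by
    refine upClosed_of ?_
    rintro l l' ⟨l₁, h1, h2, ⟨a, ha, hal⟩, ⟨b, hb, hbl⟩⟩ h' hs
    obtain rfl := enc_injective h1
    exact ⟨l', rfl, h', ⟨a, ha, fun x hx => hs (hal x hx)⟩, ⟨b, hb, fun x hx => hs (hbl x hx)⟩⟩

/-- The existential quantifier along a map, on the fibre indexed by `J`: the potential realizers
are `⋃ j, !(φ j)₁` and the actual ones the upward closure of `{⟨n⟩ | ∃ j, n ∈ (φ j)₀}`. -/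
def ex {J : Type w} (φ : J → Sig P) : Sig P where
  act := {n | ∃ l : List P, n = enc l ∧ (∀ x ∈ l, ∃ j, x ∈ bang (φ j).pot) ∧
    ∃ m ∈ l, ∃ j, m ∈ (φ j).act}
  pot := {x | ∃ j, x ∈ bang (φ j).pot}
  act_sub := by
    rintro n ⟨l, rfl, h, -⟩
    exact ⟨l, h, rfl⟩
  up := by
    refine upClosed_of ?_
    rintro l l' ⟨l₁, h1, h2, m, hm, hj⟩ h' hs
    obtain rfl := enc_injective h1
    exact ⟨l', rfl, h', m, hs hm, hj⟩

end Sig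

namespace Entails

variable {I : Type w}

/-- Entailment in terms of sequences rather than codes. -/
theorem of_list {φ ψ : I → Sig P} (r : P) (F : List P → List P)
    (h1 : ∀ i, ∀ l : List P, (∀ a ∈ l, a ∈ (φ i).pot) →
      app r (enc l) = Part.some (enc (F l)) ∧ ∀ a ∈ F l, a ∈ (ψ i).pot)
    (h2 : ∀ i, ∀ l : List P, (∀ a ∈ l, a ∈ (φ i).pot) → enc l ∈ (φ i).act →
      enc (F l) ∈ (ψ i).act) : Entails φ ψ := by
  refine ⟨r, fun i => ⟨?_, ?_⟩⟩
  · rintro n ⟨l, hl, rfl⟩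
    obtain ⟨h, h'⟩ := h1 i l hl
    exact ⟨enc (F l), by rw [h]; exact Part.mem_some _, F l, h', rfl⟩
  · intro n hn
    obtain ⟨l, hl, rfl⟩ := (φ i).act_sub hn
    exact ⟨enc (F l), by rw [(h1 i l hl).1]; exact Part.mem_some _, h2 i l hl hn⟩

/-- A realizer, as a function on sequences. -/
theorem exists_list {φ ψ : I → Sig P} (h : Entails φ ψ) : ∃ (r : P) (F : List P → List P),
    (∀ i, ∀ l : List P, (∀ a ∈ l, a ∈ (φ i).pot) →
      app r (enc l) = Part.some (enc (F l)) ∧ ∀ a ∈ F l, a ∈ (ψ i).pot) ∧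
    (∀ i, ∀ l : List P, (∀ a ∈ l, a ∈ (φ i).pot) → enc l ∈ (φ i).act →
      enc (F l) ∈ (ψ i).act) := by
  classical
  obtain ⟨r, hr⟩ := h
  refine ⟨r, fun l => if h : ∃ l', enc l' ∈ app r (enc l) then h.choose else [], ?_, ?_⟩
  · intro i l hl
    obtain ⟨m, hm, l', hl', rfl⟩ := (hr i).1 _ (mem_bang.2 hl)
    have hex : ∃ l', enc l' ∈ app r (enc l) := ⟨l', hm⟩
    have e : hex.choose = l' := enc_injective (Part.mem_unique hex.choose_spec hm)
    simp only [dif_pos hex, e]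
    exact ⟨Part.eq_some_iff.2 hm, hl'⟩
  · intro i l hl ha
    obtain ⟨m, hm, hm'⟩ := (hr i).2 _ ha
    obtain ⟨l', hl', rfl⟩ := (ψ i).act_sub hm'
    have hex : ∃ l', enc l' ∈ app r (enc l) := ⟨l', hm⟩
    have e : hex.choose = l' := enc_injective (Part.mem_unique hex.choose_spec hm)
    simpa only [dif_pos hex, e] using hm'

theorem refl (φ : I → Sig P) : Entails φ φ :=
  of_list idc id (fun _ _ h => ⟨by simp, h⟩) (fun _ _ _ h => h)

theorem reindex {J : Type v₁} {φ ψ : I → Sig P} (h : Entails φ ψ) (g : J → I) :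
    Entails (fun j => φ (g j)) (fun j => ψ (g j)) :=
  h.imp fun _ hr j => hr (g j)

theorem trans {φ ψ χ : I → Sig P} (h : Entails φ ψ) (h' : Entails ψ χ) : Entails φ χ := by
  obtain ⟨r, F, h1, h2⟩ := h.exists_list
  obtain ⟨r', F', h1', h2'⟩ := h'.exists_list
  let t : Tm P := .app (.const r') (.app (.const r) (.var 0))
  refine of_list (t.lamVal fun _ => idc) (fun l => F' (F l)) (fun i l hl => ?_)
    (fun i l hl ha => h2' i _ (h1 i l hl).2 (h2 i l hl ha))
  obtain ⟨e, hF⟩ := h1 i l hl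
  obtain ⟨e', hF'⟩ := h1' i _ hF
  refine ⟨?_, hF'⟩
  simp [Tm.app_lamVal, t, Tm.eval, push, e, e']

theorem pair0_ne (a b : P) : pair church0 a ≠ pair church1 b :=
  fun h => church_ne (pair_inj h).1

open Classical in
/-- The components of a sequence in `A & B` with the given tag. -/
def part (c : P) (l : List P) : List P :=
  l.flatMap fun x => if h : ∃ y, x = pair c y then [h.choose] else []

theorem mem_part {c : P} {l : List P} {y : P} : y ∈ part c l ↔ pair c y ∈ l := by
  classical
  simp only [part, List.mem_flatMap]
  constructor
  · rintro ⟨x, hx, hy⟩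
    split_ifs at hy with h
    · obtain rfl := List.mem_singleton.1 hy
      rwa [← h.choose_spec]
    · simp at hy
  · intro h
    refine ⟨_, h, ?_⟩
    have hex : ∃ z, pair c y = pair c z := ⟨y, rfl⟩
    rw [dif_pos hex]
    exact List.mem_singleton.2 (pair_inj hex.choose_spec).2

/-- Both projections `!(A & B) → !A` and `!(A & B) → !B` are represented. -/
theorem exists_part0 : ∃ r : P, ∀ l : List P, (∀ x ∈ l, x ∈ amp (Set.univ : Set P) Set.univ) →
    app r (enc l) = Part.some (enc (part church0 l)) := by
  obtain ⟨f, hf⟩ := exists_cons (P := P)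
  let snd : Tm P := .app (.var 0) (.const (k1 idc))
  let fst : Tm P := .app (.var 0) (.const PCA.k)
  let cons : Tm P := .app (.app (.app (.const f) (.var 0)) snd) (.const (enc []))
  let t : Tm P := .app (.app fst (.const (k1 (enc [])))) cons
  obtain ⟨R, hR⟩ := exists_flatMap (t.lam.lamVal fun _ => idc)
  obtain ⟨Rc, -, h⟩ := hR idc
  refine ⟨Rc, fun l hl => h l _ fun x hx => ?_⟩
  rcases hl x hx with ⟨a, -, rfl⟩ | ⟨b, -, rfl⟩
  · have hex : ∃ y, pair church0 a = pair church0 y := ⟨a, rfl⟩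
    rw [dif_pos hex, ← (pair_inj hex.choose_spec).2]
    simp [Tm.app_lamVal, Tm.eval_lam, t, fst, snd, cons, Tm.eval, push, hf, app_pair_k, app_pair_ki]
    rfl
  · rw [dif_neg (by rintro ⟨y, hy⟩; exact pair0_ne _ _ hy.symm)]
    simp [Tm.app_lamVal, Tm.eval_lam, t, fst, snd, cons, Tm.eval, push, hf, app_pair_k,
      app_pair_ki, app_church1]

theorem exists_part1 : ∃ r : P, ∀ l : List P, (∀ x ∈ l, x ∈ amp (Set.univ : Set P) Set.univ) →
    app r (enc l) = Part.some (enc (part church1 l)) := by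
  obtain ⟨f, hf⟩ := exists_cons (P := P)
  let snd : Tm P := .app (.var 0) (.const (k1 idc))
  let fst : Tm P := .app (.var 0) (.const PCA.k)
  let cons : Tm P := .app (.app (.app (.const f) (.var 0)) snd) (.const (enc []))
  let t : Tm P := .app (.app fst (.app (.const PCA.k) cons)) (.const (enc []))
  obtain ⟨R, hR⟩ := exists_flatMap (t.lam.lamVal fun _ => idc)
  obtain ⟨Rc, -, h⟩ := hR idc
  refine ⟨Rc, fun l hl => h l _ fun x hx => ?_⟩
  rcases hl x hx with ⟨a, -, rfl⟩ | ⟨b, -, rfl⟩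
  · rw [dif_neg (by rintro ⟨y, hy⟩; exact pair0_ne _ _ hy)]
    simp [Tm.app_lamVal, Tm.eval_lam, t, fst, snd, cons, Tm.eval, push, hf, app_pair_k,
      app_pair_ki, app_k]
  · have hex : ∃ y, pair church1 b = pair church1 y := ⟨b, rfl⟩
    rw [dif_pos hex, ← (pair_inj hex.choose_spec).2]
    simp [Tm.app_lamVal, Tm.eval_lam, t, fst, snd, cons, Tm.eval, push, hf, app_pair_k,
      app_pair_ki, app_church1, app_k]
    rfl

theorem amp_mono {A B : Set P} {x : P} (h : x ∈ amp A B) :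
    x ∈ amp (Set.univ : Set P) Set.univ :=
  h.imp (fun ⟨a, _, e⟩ => ⟨a, trivial, e⟩) (fun ⟨a, _, e⟩ => ⟨a, trivial, e⟩)

theorem mem_part0 {A B : Set P} {l : List P} (h : ∀ x ∈ l, x ∈ amp A B) :
    ∀ a ∈ part church0 l, a ∈ A := by
  intro a ha
  rcases h _ (mem_part.1 ha) with ⟨a', h', e⟩ | ⟨b, h', e⟩
  · rwa [(pair_inj e).2]
  · exact absurd e (pair0_ne _ _)

theorem mem_part1 {A B : Set P} {l : List P} (h : ∀ x ∈ l, x ∈ amp A B) :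
    ∀ a ∈ part church1 l, a ∈ B := by
  intro a ha
  rcases h _ (mem_part.1 ha) with ⟨a', h', e⟩ | ⟨b, h', e⟩
  · exact absurd e.symm (pair0_ne _ _)
  · rwa [(pair_inj e).2]

theorem and_left (φ ψ : I → Sig P) : Entails (fun i => (φ i).and (ψ i)) φ := by
  obtain ⟨r, hr⟩ := exists_part0 (P := P)
  refine of_list r (part church0) (fun i l hl => ⟨hr l fun x hx => amp_mono (hl x hx),
    mem_part0 hl⟩) ?_
  rintro i l hl ⟨l', e, -, ⟨a, ha, hal⟩, -⟩
  obtain rfl := enc_injective e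
  exact enc_mem_of_up (φ i).up ha (mem_part0 hl) fun x hx => mem_part.2 (hal x hx)

theorem and_right (φ ψ : I → Sig P) : Entails (fun i => (φ i).and (ψ i)) ψ := by
  obtain ⟨r, hr⟩ := exists_part1 (P := P)
  refine of_list r (part church1) (fun i l hl => ⟨hr l fun x hx => amp_mono (hl x hx),
    mem_part1 hl⟩) ?_
  rintro i l hl ⟨l', e, -, -, ⟨a, ha, hal⟩⟩
  obtain rfl := enc_injective e
  exact enc_mem_of_up (ψ i).up ha (mem_part1 hl) fun x hx => mem_part.2 (hal x hx)

/-- The sequence corresponding to a pair of sequences. -/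
def conj (l m : List P) : List P := l.map (pair church0) ++ m.map (pair church1)

theorem exists_tag (c : P) : ∃ r : P, ∀ l : List P,
    app r (enc l) = Part.some (enc (l.map (pair c))) := by
  obtain ⟨f, hf⟩ := exists_cons (P := P)
  obtain ⟨p, hp⟩ := exists_pair (P := P)
  let t : Tm P := .app (.app (.app (.const f) (.var 0)) (.app (.app (.const p) (.const c)) (.var 0)))
    (.const (enc []))
  obtain ⟨R, hR⟩ := exists_flatMap (t.lam.lamVal fun _ => idc)
  obtain ⟨Rc, -, h⟩ := hR idc
  refine ⟨Rc, fun l => ?_⟩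
  rw [h l (fun a => [pair c a]), List.map_eq_flatMap]
  intro a _
  simp [Tm.app_lamVal, Tm.eval_lam, t, Tm.eval, push, hf, hp]
  rfl

theorem exists_conj : ∃ r : P, ∀ l m : List P,
    papp (app r (enc l)) (Part.some (enc m)) = Part.some (enc (conj l m)) := by
  obtain ⟨ap, hap⟩ := exists_append (P := P)
  obtain ⟨r0, h0⟩ := exists_tag (church0 : P)
  obtain ⟨r1, h1⟩ := exists_tag (church1 : P)
  let t : Tm P := .app (.app (.const ap) (.app (.const r1) (.var 0))) (.app (.const r0) (.var 1))
  refine ⟨t.lam.lamVal fun _ => idc, fun l m => ?_⟩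
  obtain ⟨Rm, h2, h3⟩ := hap (m.map (pair church1))
  simp [Tm.app_lamVal, Tm.eval_lam, t, Tm.eval, push, h0, h1, h2, h3, conj]

theorem conj_pot {A B : Set P} {l m : List P} (hl : ∀ a ∈ l, a ∈ A) (hm : ∀ a ∈ m, a ∈ B) :
    ∀ x ∈ conj l m, x ∈ amp A B := by
  intro x hx
  rcases List.mem_append.1 hx with h | h
  · obtain ⟨a, ha, rfl⟩ := List.mem_map.1 h
    exact Or.inl ⟨a, hl a ha, rfl⟩
  · obtain ⟨a, ha, rfl⟩ := List.mem_map.1 h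
    exact Or.inr ⟨a, hm a ha, rfl⟩

theorem conj_act {A B : Sig P} {l m : List P} (hl : enc l ∈ A.act) (hm : enc m ∈ B.act) :
    enc (conj l m) ∈ (A.and B).act :=
  ⟨_, rfl, conj_pot (mem_bang.1 (A.act_sub hl)) (mem_bang.1 (B.act_sub hm)),
    ⟨l, hl, fun _ hx => List.mem_append_left _ (List.mem_map_of_mem hx)⟩,
    ⟨m, hm, fun _ hx => List.mem_append_right _ (List.mem_map_of_mem hx)⟩⟩

theorem and_intro {χ φ ψ : I → Sig P} (h : Entails χ φ) (h' : Entails χ ψ) :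
    Entails χ (fun i => (φ i).and (ψ i)) := by
  obtain ⟨r, F, h1, h2⟩ := h.exists_list
  obtain ⟨r', F', h1', h2'⟩ := h'.exists_list
  obtain ⟨c, hc⟩ := exists_conj (P := P)
  let t : Tm P := .app (.app (.const c) (.app (.const r) (.var 0))) (.app (.const r') (.var 0))
  refine of_list (t.lamVal fun _ => idc) (fun l => conj (F l) (F' l)) (fun i l hl => ?_)
    (fun i l hl ha => conj_act (h2 i l hl ha) (h2' i l hl ha))
  obtain ⟨e, hF⟩ := h1 i l hl
  obtain ⟨e', hF'⟩ := h1' i l hl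
  refine ⟨?_, conj_pot hF hF'⟩
  simp [Tm.app_lamVal, t, Tm.eval, push, e, e', hc]

theorem ex_intro {J : Type v₁} {χ : I → Sig P} {φ : I → J → Sig P} (j : I → J)
    (h : Entails χ (fun i => φ i (j i))) : Entails χ (fun i => Sig.ex (φ i)) := by
  obtain ⟨r, F, h1, h2⟩ := h.exists_list
  obtain ⟨f, hf⟩ := exists_cons (P := P)
  let t : Tm P := .app (.app (.app (.const f) (.var 0)) (.app (.const r) (.var 0)))
    (.const (enc []))
  refine of_list (t.lamVal fun _ => idc) (fun l => [enc (F l)]) (fun i l hl => ?_) ?_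
  · obtain ⟨e, hF⟩ := h1 i l hl
    refine ⟨?_, ?_⟩
    · simp [Tm.app_lamVal, t, Tm.eval, push, e, hf]
      rfl
    · intro a ha
      obtain rfl := List.mem_singleton.1 ha
      exact ⟨j i, mem_bang.2 hF⟩
  · intro i l hl ha
    refine ⟨_, rfl, ?_, enc (F l), List.mem_singleton_self _, j i, h2 i l hl ha⟩
    intro a ha
    obtain rfl := List.mem_singleton.1 ha
    exact ⟨j i, mem_bang.2 (h1 i l hl).2⟩

/-- Elimination of the existential quantifier, with a side condition `χ`. -/
theorem ex_elim {J : Type v₁} {χ ψ : I → Sig P} {φ : I → J → Sig P}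
    (h : Entails (fun p : I × J => (χ p.1).and (φ p.1 p.2)) (fun p => ψ p.1)) :
    Entails (fun i => (χ i).and (Sig.ex (φ i))) ψ := by
  classical
  obtain ⟨r, F, h1, h2⟩ := h.exists_list
  obtain ⟨c, hc⟩ := exists_conj (P := P)
  obtain ⟨q0, hq0⟩ := exists_part0 (P := P)
  obtain ⟨q1, hq1⟩ := exists_part1 (P := P)
  let t : Tm P := .app (.const r) (.app (.app (.const c) (.var 1)) (.var 0))
  obtain ⟨R, hR⟩ := exists_flatMap (t.lam.lamVal fun _ => idc)
  let t' : Tm P := .app (.app (.const R) (.app (.const q0) (.var 0))) (.app (.const q1) (.var 0))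
  let dec : P → List P := fun x => if h : ∃ m, x = enc m then h.choose else []
  have hdec : ∀ m : List P, dec (enc m) = m := fun m => by
    have hex : ∃ m', enc m = enc m' := ⟨m, rfl⟩
    simp only [dec, dif_pos hex]
    exact (enc_injective hex.choose_spec).symm
  refine of_list (t'.lamVal fun _ => idc)
    (fun l => (part church1 l).flatMap fun x => F (conj (part church0 l) (dec x))) ?_ ?_
  · intro i l hl
    have hl0 := mem_part0 hl
    have hl1 := mem_part1 hl
    obtain ⟨Rc, hRc, hf⟩ := hR (enc (part church0 l))
    have key : ∀ x ∈ part church1 l, papp (app (t.lam.lamVal fun _ => idc) (enc (part church0 l)))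
        (Part.some x) = Part.some (enc (F (conj (part church0 l) (dec x)))) ∧
        ∀ a ∈ F (conj (part church0 l) (dec x)), a ∈ (ψ i).pot := by
      intro x hx
      obtain ⟨j, m, hm, rfl⟩ := hl1 x hx
      obtain ⟨e, he⟩ := h1 (i, j) (conj (part church0 l) m) (conj_pot hl0 hm)
      rw [hdec]
      refine ⟨?_, he⟩
      simp [Tm.app_lamVal, Tm.eval_lam, t, Tm.eval, push, hc, e]
    refine ⟨?_, ?_⟩
    · have e0 := hq0 l fun x hx => amp_mono (hl x hx)
      have e1 := hq1 l fun x hx => amp_mono (hl x hx)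
      have e2 := hf (part church1 l) (fun x => F (conj (part church0 l) (dec x)))
        fun x hx => (key x hx).1
      rw [Tm.app_lamVal]
      simp only [t', Tm.eval, push, papp_some, e0, e1, hRc, e2]
    · intro a ha
      obtain ⟨x, hx, hax⟩ := List.mem_flatMap.1 ha
      exact (key x hx).2 a hax
  · rintro i l hl ⟨l', e, -, ⟨a, ha, hal⟩, ⟨b, ⟨b', eb, hb, m, hm, j, hj⟩, hbl⟩⟩
    obtain rfl := enc_injective e
    obtain rfl := enc_injective eb
    have hl0 := mem_part0 hl
    have hl1 := mem_part1 hl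
    obtain ⟨m, hm', rfl⟩ := (φ i j).act_sub hj
    have ha' : enc (part church0 l) ∈ (χ i).act :=
      enc_mem_of_up (χ i).up ha hl0 fun x hx => mem_part.2 (hal x hx)
    have h3 := h2 (i, j) _ (conj_pot hl0 hm') (conj_act ha' hj)
    refine enc_mem_of_up (ψ i).up h3 ?_ ?_
    · intro y hy
      obtain ⟨x, hx, hax⟩ := List.mem_flatMap.1 hy
      obtain ⟨j', m', hm', rfl⟩ := hl1 x hx
      rw [hdec] at hax
      exact (h1 (i, j') _ (conj_pot hl0 hm')).2 y hax
    · intro y hy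
      refine List.mem_flatMap.2 ⟨enc m, mem_part.2 (hbl _ hm), ?_⟩
      rwa [hdec]

end Entails

end Tripos

/-! ### The Herbrand topos -/

section Topos

variable (P : Type u) [PCA P] [Nontrivial P]

/-- Objects of the Herbrand topos: sets with a `Sig P`-valued partial equivalence relation. -/
structure HT where
  carrier : Type u
  eq : carrier → carrier → Sig P
  symm : Entails (fun p : carrier × carrier => eq p.1 p.2) (fun p => eq p.2 p.1)
  trans : Entails (fun p : carrier × carrier × carrier => (eq p.1 p.2.1).and (eq p.2.1 p.2.2))
    (fun p => eq p.1 p.2.2)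

variable {P}

/-- Functional relations between objects of the Herbrand topos. -/
structure FunRel (X Y : HT P) where
  rel : X.carrier → Y.carrier → Sig P
  strict : Entails (fun p : X.carrier × Y.carrier => rel p.1 p.2)
    (fun p => (X.eq p.1 p.1).and (Y.eq p.2 p.2))
  congr : Entails (fun p : (X.carrier × X.carrier) × (Y.carrier × Y.carrier) =>
      (rel p.1.1 p.2.1).and ((X.eq p.1.1 p.1.2).and (Y.eq p.2.1 p.2.2)))
    (fun p => rel p.1.2 p.2.2)
  single : Entails (fun p : X.carrier × Y.carrier × Y.carrier =>
      (rel p.1 p.2.1).and (rel p.1 p.2.2))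
    (fun p => Y.eq p.2.1 p.2.2)
  total : Entails (fun x => X.eq x x) (fun x => Sig.ex (rel x))

namespace FunRel

/-- Entailment of relations. -/
def LE {X Y : HT P} (F G : FunRel X Y) : Prop :=
  Entails (fun p : X.carrier × Y.carrier => F.rel p.1 p.2) (fun p => G.rel p.1 p.2)

open Entails

theorem LE.symm {X Y : HT P} {F G : FunRel X Y} (h : F.LE G) : G.LE F := by
  have h1 : Entails (fun p : X.carrier × Y.carrier => G.rel p.1 p.2)
      (fun p => (G.rel p.1 p.2).and (Sig.ex (F.rel p.1))) :=
    and_intro (refl _) ((G.strict.trans (and_left _ _)).trans (F.total.reindex Prod.fst))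
  refine h1.trans (ex_elim ?_)
  have hG := and_left (fun p : (X.carrier × Y.carrier) × Y.carrier => G.rel p.1.1 p.1.2)
    (fun p => F.rel p.1.1 p.2)
  have hF := and_right (fun p : (X.carrier × Y.carrier) × Y.carrier => G.rel p.1.1 p.1.2)
    (fun p => F.rel p.1.1 p.2)
  have hG' := hF.trans (h.reindex fun p : (X.carrier × Y.carrier) × Y.carrier => (p.1.1, p.2))
  have he := (and_intro hG' hG).trans
    (G.single.reindex fun p : (X.carrier × Y.carrier) × Y.carrier => (p.1.1, p.2, p.1.2))
  have hx := hF.trans ((F.strict.trans (and_left _ _)).reindex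
    fun p : (X.carrier × Y.carrier) × Y.carrier => (p.1.1, p.2))
  exact (and_intro hF (and_intro hx he)).trans (F.congr.reindex
    fun p : (X.carrier × Y.carrier) × Y.carrier => ((p.1.1, p.1.1), (p.2, p.1.2)))

/-- Functional relations are identified when they entail each other. -/
instance setoid (X Y : HT P) : Setoid (FunRel X Y) where
  r F G := F.LE G ∧ G.LE F
  iseqv := ⟨fun _ => ⟨refl _, refl _⟩, fun h => ⟨h.2, h.1⟩,
    fun h h' => ⟨Entails.trans h.1 h'.1, Entails.trans h'.2 h.2⟩⟩

theorem LE.equiv {X Y : HT P} {F G : FunRel X Y} (h : F.LE G) : F ≈ G := ⟨h, h.symm⟩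

/-- The identity: the equality predicate. -/
def id (X : HT P) : FunRel X X where
  rel := X.eq
  strict := by
    have hs := X.symm
    refine and_intro ?_ ?_
    · exact (and_intro (refl _) hs).trans
        (X.trans.reindex fun p : X.carrier × X.carrier => (p.1, p.2, p.1))
    · exact (and_intro hs (refl _)).trans
        (X.trans.reindex fun p : X.carrier × X.carrier => (p.2, p.1, p.2))
  congr := by
    let I := (X.carrier × X.carrier) × (X.carrier × X.carrier)
    have h1 := and_left (fun p : I => X.eq p.1.1 p.2.1)
      (fun p => (X.eq p.1.1 p.1.2).and (X.eq p.2.1 p.2.2))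
    have h2 := and_right (fun p : I => X.eq p.1.1 p.2.1)
      (fun p => (X.eq p.1.1 p.1.2).and (X.eq p.2.1 p.2.2))
    have h3 := (h2.trans (and_left _ _)).trans (X.symm.reindex fun p : I => p.1)
    have h4 := h2.trans (and_right _ _)
    have h5 := (and_intro h3 h1).trans (X.trans.reindex fun p : I => (p.1.2, p.1.1, p.2.1))
    exact (and_intro h5 h4).trans (X.trans.reindex fun p : I => (p.1.2, p.2.1, p.2.2))
  single := by
    let I := X.carrier × X.carrier × X.carrier
    have h1 := (and_left (fun p : I => X.eq p.1 p.2.1) (fun p => X.eq p.1 p.2.2)).trans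
      (X.symm.reindex fun p : I => (p.1, p.2.1))
    have h2 := and_right (fun p : I => X.eq p.1 p.2.1) (fun p => X.eq p.1 p.2.2)
    exact (and_intro h1 h2).trans (X.trans.reindex fun p : I => (p.2.1, p.1, p.2.2))
  total := ex_intro (fun x => x) (refl _)

theorem ex_elim' {I : Type w} {J : Type v₁} {φ : I → J → Sig P} {ψ : I → Sig P}
    (h : Entails (fun p : I × J => φ p.1 p.2) (fun p => ψ p.1)) :
    Entails (fun i => Sig.ex (φ i)) ψ :=
  (and_intro (refl _) (refl _)).trans (ex_elim (χ := fun i => Sig.ex (φ i))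
    ((and_right _ _).trans h))

/-- Composition: `∃ y, F(x, y) ∧ G(y, z)`. -/
def comp {X Y Z : HT P} (F : FunRel X Y) (G : FunRel Y Z) : FunRel X Z where
  rel x z := Sig.ex fun y => (F.rel x y).and (G.rel y z)
  strict := by
    refine ex_elim' ?_
    let I := (X.carrier × Z.carrier) × Y.carrier
    have h1 := (and_left (fun p : I => F.rel p.1.1 p.2) (fun p => G.rel p.2 p.1.2)).trans
      (F.strict.reindex fun p : I => (p.1.1, p.2))
    have h2 := (and_right (fun p : I => F.rel p.1.1 p.2) (fun p => G.rel p.2 p.1.2)).trans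
      (G.strict.reindex fun p : I => (p.2, p.1.2))
    exact and_intro (h1.trans (and_left _ _)) (h2.trans (and_right _ _))
  congr := by
    let I := (X.carrier × X.carrier) × (Z.carrier × Z.carrier)
    refine (and_intro (and_right _ _) (and_left _ _)).trans (ex_elim ?_)
    let J := I × Y.carrier
    have hE := and_left (fun p : J => (X.eq p.1.1.1 p.1.1.2).and (Z.eq p.1.2.1 p.1.2.2))
      (fun p => (F.rel p.1.1.1 p.2).and (G.rel p.2 p.1.2.1))
    have hR := and_right (fun p : J => (X.eq p.1.1.1 p.1.1.2).and (Z.eq p.1.2.1 p.1.2.2))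
      (fun p => (F.rel p.1.1.1 p.2).and (G.rel p.2 p.1.2.1))
    have hF := hR.trans (and_left _ _)
    have hG := hR.trans (and_right _ _)
    have hY := hF.trans ((F.strict.trans (and_right _ _)).reindex
      fun p : J => (p.1.1.1, p.2))
    have hF' := (and_intro hF (and_intro (hE.trans (and_left _ _)) hY)).trans
      (F.congr.reindex fun p : J => ((p.1.1.1, p.1.1.2), (p.2, p.2)))
    have hG' := (and_intro hG (and_intro hY (hE.trans (and_right _ _)))).trans
      (G.congr.reindex fun p : J => ((p.2, p.2), (p.1.2.1, p.1.2.2)))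
    exact ex_intro (φ := fun (p : J) y => (F.rel p.1.1.2 y).and (G.rel y p.1.2.2))
      (fun p : J => p.2) (and_intro hF' hG')
  single := by
    refine ex_elim ?_
    refine (and_intro (and_right _ _) (and_left _ _)).trans (ex_elim ?_)
    let J := ((X.carrier × Z.carrier × Z.carrier) × Y.carrier) × Y.carrier
    have h1 := and_left (fun p : J => (F.rel p.1.1.1 p.1.2).and (G.rel p.1.2 p.1.1.2.2))
      (fun p => (F.rel p.1.1.1 p.2).and (G.rel p.2 p.1.1.2.1))
    have h2 := and_right (fun p : J => (F.rel p.1.1.1 p.1.2).and (G.rel p.1.2 p.1.1.2.2))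
      (fun p => (F.rel p.1.1.1 p.2).and (G.rel p.2 p.1.1.2.1))
    have hy := (and_intro (h2.trans (and_left _ _)) (h1.trans (and_left _ _))).trans
      (F.single.reindex fun p : J => (p.1.1.1, p.2, p.1.2))
    have hG := h2.trans (and_right _ _)
    have hz := hG.trans ((G.strict.trans (and_right _ _)).reindex
      fun p : J => (p.2, p.1.1.2.1))
    have hG' := (and_intro hG (and_intro hy hz)).trans
      (G.congr.reindex fun p : J => ((p.2, p.1.2), (p.1.1.2.1, p.1.1.2.1)))
    exact (and_intro hG' (h1.trans (and_right _ _))).trans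
      (G.single.reindex fun p : J => (p.1.2, p.1.1.2.1, p.1.1.2.2))
  total := by
    refine F.total.trans (ex_elim' ?_)
    let I := X.carrier × Y.carrier
    have hy := (F.strict.trans (and_right _ _)).trans (G.total.reindex fun p : I => p.2)
    refine (and_intro (refl _) hy).trans (ex_elim ?_)
    let J := I × Z.carrier
    exact ex_intro (φ := fun (p : J) z => Sig.ex fun y => (F.rel p.1.1 y).and (G.rel y z))
      (fun p : J => p.2) (ex_intro (φ := fun (p : J) y => (F.rel p.1.1 y).and (G.rel y p.2))
        (fun p : J => p.1.2) (refl _))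

theorem comp_le {X Y Z : HT P} {F F' : FunRel X Y} {G G' : FunRel Y Z} (h : F.LE F')
    (h' : G.LE G') : (F.comp G).LE (F'.comp G') := by
  refine ex_elim' ?_
  let I := (X.carrier × Z.carrier) × Y.carrier
  refine ex_intro (φ := fun (p : I) y => (F'.rel p.1.1 y).and (G'.rel y p.1.2))
    (fun p : I => p.2) (and_intro ?_ ?_)
  · exact (and_left _ _).trans (Entails.reindex h fun p : I => (p.1.1, p.2))
  · exact (and_right _ _).trans (Entails.reindex h' fun p : I => (p.2, p.1.2))

theorem id_comp_le {X Y : HT P} (F : FunRel X Y) : ((FunRel.id X).comp F).LE F := by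
  refine ex_elim' ?_
  let I := (X.carrier × Y.carrier) × X.carrier
  have h1 := and_left (fun p : I => X.eq p.1.1 p.2) (fun p => F.rel p.2 p.1.2)
  have h2 := and_right (fun p : I => X.eq p.1.1 p.2) (fun p => F.rel p.2 p.1.2)
  have hx := h1.trans (X.symm.reindex fun p : I => (p.1.1, p.2))
  have hy := h2.trans ((F.strict.trans (and_right _ _)).reindex fun p : I => (p.2, p.1.2))
  exact (and_intro h2 (and_intro hx hy)).trans
    (F.congr.reindex fun p : I => ((p.2, p.1.1), (p.1.2, p.1.2)))

theorem comp_id_le {X Y : HT P} (F : FunRel X Y) : (F.comp (FunRel.id Y)).LE F := by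
  refine ex_elim' ?_
  let I := (X.carrier × Y.carrier) × Y.carrier
  have h1 := and_left (fun p : I => F.rel p.1.1 p.2) (fun p => Y.eq p.2 p.1.2)
  have h2 := and_right (fun p : I => F.rel p.1.1 p.2) (fun p => Y.eq p.2 p.1.2)
  have hx := h1.trans ((F.strict.trans (and_left _ _)).reindex fun p : I => (p.1.1, p.2))
  exact (and_intro h1 (and_intro hx h2)).trans
    (F.congr.reindex fun p : I => ((p.1.1, p.1.1), (p.2, p.1.2)))

theorem assoc_le {W X Y Z : HT P} (F : FunRel W X) (G : FunRel X Y) (H : FunRel Y Z) :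
    ((F.comp G).comp H).LE (F.comp (G.comp H)) := by
  refine ex_elim' ?_
  refine (and_intro (and_right _ _) (and_left _ _)).trans (ex_elim ?_)
  let J := ((W.carrier × Z.carrier) × Y.carrier) × X.carrier
  have h1 := and_left (fun p : J => H.rel p.1.2 p.1.1.2)
    (fun p => (F.rel p.1.1.1 p.2).and (G.rel p.2 p.1.2))
  have h2 := and_right (fun p : J => H.rel p.1.2 p.1.1.2)
    (fun p => (F.rel p.1.1.1 p.2).and (G.rel p.2 p.1.2))
  refine ex_intro (φ := fun (p : J) x => (F.rel p.1.1.1 x).and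
    (Sig.ex fun y => (G.rel x y).and (H.rel y p.1.1.2))) (fun p : J => p.2)
    (and_intro (h2.trans (and_left _ _)) ?_)
  exact ex_intro (φ := fun (p : J) y => (G.rel p.2 y).and (H.rel y p.1.1.2)) (fun p : J => p.1.2)
    (and_intro (h2.trans (and_right _ _)) h1)

end FunRel

/-- The Herbrand topos: the category of `Sig P`-valued partial equivalence relations, with
functional relations up to equivalence as morphisms. -/
instance HT.category : LargeCategory (HT P) where
  Hom X Y := Quotient (FunRel.setoid X Y)
  id X := Quotient.mk _ (FunRel.id X)
  comp {X Y Z} := Quotient.map₂ (sa := FunRel.setoid X Y) (sb := FunRel.setoid Y Z)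
    (sc := FunRel.setoid X Z) FunRel.comp
    (fun _ _ h _ _ h' => (FunRel.comp_le h.1 h'.1).equiv)
  id_comp f := by
    induction f using Quotient.inductionOn with
    | h F => exact Quotient.sound (FunRel.id_comp_le F).equiv
  comp_id f := by
    induction f using Quotient.inductionOn with
    | h F => exact Quotient.sound (FunRel.comp_id_le F).equiv
  assoc f g h := by
    induction f using Quotient.inductionOn with
    | h F =>
      induction g using Quotient.inductionOn with
      | h G =>
        induction h using Quotient.inductionOn with
        | h H => exact Quotient.sound (FunRel.assoc_le F G H).equiv

/-- The morphism represented by a functional relation. -/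
def FunRel.hom {X Y : HT P} (F : FunRel X Y) : X ⟶ Y := Quotient.mk _ F

theorem FunRel.hom_eq {X Y : HT P} {F G : FunRel X Y} (h : F.LE G) : F.hom = G.hom :=
  Quotient.sound h.equiv

/-! ### Herbrand assemblies and the functor `∇` -/

variable (P)

/-- Herbrand assemblies `(A, 𝒜, α)`. -/
structure HAsm where
  carrier : Type u
  pot : Set P
  real : carrier → Set P
  real_sub : ∀ a, real a ⊆ bang pot
  real_nonempty : ∀ a, (real a).Nonempty
  real_up : ∀ a, UpClosed pot (real a)

variable {P}

/-- `n` tracks the function `f`. -/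
def HAsm.Tracks {B A : HAsm P} (n : P) (f : B.carrier → A.carrier) : Prop :=
  (∀ m ∈ bang B.pot, ∃ m' ∈ app n m, m' ∈ bang A.pot) ∧
    ∀ b, ∀ m ∈ B.real b, ∃ m' ∈ app n m, m' ∈ A.real (f b)

/-- Morphisms of Herbrand assemblies: tracked functions. -/
@[ext]
structure HAsm.Hom (B A : HAsm P) where
  fn : B.carrier → A.carrier
  tracked : ∃ n : P, HAsm.Tracks n fn

instance HAsm.category : LargeCategory (HAsm P) where
  Hom := HAsm.Hom
  id A := ⟨fun a => a, idc, fun m hm => ⟨m, by simp, hm⟩, fun _ m hm => ⟨m, by simp, hm⟩⟩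
  comp {A B C} f g := ⟨fun a => g.fn (f.fn a), by
    obtain ⟨r, h1, h2⟩ := f.tracked
    obtain ⟨r', h1', h2'⟩ := g.tracked
    let t : Tm P := .app (.const r') (.app (.const r) (.var 0))
    have ht : ∀ {m m' m'' : P}, m' ∈ app r m → m'' ∈ app r' m' →
        m'' ∈ app (t.lamVal fun _ => idc) m := by
      intro m m' m'' h h'
      simp [Tm.app_lamVal, t, Tm.eval, push, Part.eq_some_iff.2 h, Part.eq_some_iff.2 h']
    refine ⟨t.lamVal fun _ => idc, fun m hm => ?_, fun b m hm => ?_⟩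
    · obtain ⟨m', h, hm'⟩ := h1 m hm
      obtain ⟨m'', h', hm''⟩ := h1' m' hm'
      exact ⟨m'', ht h h', hm''⟩
    · obtain ⟨m', h, hm'⟩ := h2 b m hm
      obtain ⟨m'', h', hm''⟩ := h2' _ m' hm'
      exact ⟨m'', ht h h', hm''⟩⟩

/-- The equality predicate of a Herbrand assembly: `(α(a), 𝒜)` if `a = a'`, and `(∅, 𝒜)`
otherwise. -/
def HAsm.eqv (A : HAsm P) (a a' : A.carrier) : Sig P where
  act := {n | a = a' ∧ n ∈ A.real a}
  pot := A.pot
  act_sub := fun _ h => A.real_sub _ h.2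
  up := fun m hm n hn h => ⟨hm.1, A.real_up a m hm.2 n hn h⟩

open Entails in
/-- A Herbrand assembly as an object of the Herbrand topos. -/
def HAsm.toHTObj (A : HAsm P) : HT P where
  carrier := A.carrier
  eq := A.eqv
  symm := ⟨idc, fun p => ⟨fun n hn => ⟨n, by simp, hn⟩, fun n hn => ⟨n, by simp, hn.1.symm, by
    simpa only [← hn.1] using hn.2⟩⟩⟩
  trans := by
    obtain ⟨r, hr⟩ := and_left (fun p : A.carrier × A.carrier × A.carrier => A.eqv p.1 p.2.1)
      (fun p => A.eqv p.2.1 p.2.2)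
    refine ⟨r, fun p => ⟨(hr p).1, fun n hn => ?_⟩⟩
    obtain ⟨m, h, h1, h2⟩ := (hr p).2 n hn
    obtain ⟨l, -, -, -, ⟨b, hb, -⟩⟩ := hn
    exact ⟨m, h, h1.trans hb.1, h2⟩

theorem HAsm.Hom.eqv_le {B A : HAsm P} (f : HAsm.Hom B A) :
    Entails (fun p : B.carrier × B.carrier => B.eqv p.1 p.2)
      (fun p => A.eqv (f.fn p.1) (f.fn p.2)) := by
  obtain ⟨n, h1, h2⟩ := f.tracked
  refine ⟨n, fun p => ⟨h1, fun m hm => ?_⟩⟩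
  obtain ⟨m', h, h'⟩ := h2 p.1 m hm.2
  exact ⟨m', h, congrArg f.fn hm.1, h'⟩

open Entails in
/-- The functional relation `⟦b = b⟧ ∧ ⟦f(b) = a⟧` given by a morphism of Herbrand assemblies. -/
def HAsm.Hom.funRel {B A : HAsm P} (f : HAsm.Hom B A) : FunRel B.toHTObj A.toHTObj where
  rel b a := (B.eqv b b).and (A.eqv (f.fn b) a)
  strict := by
    refine and_intro (and_left _ _) ((and_right _ _).trans ?_)
    exact ((FunRel.id A.toHTObj).strict.trans (and_right _ _)).reindex
      fun p : B.carrier × A.carrier => (f.fn p.1, p.2)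
  congr := by
    let I := (B.carrier × B.carrier) × (A.carrier × A.carrier)
    have h1 := and_left (fun p : I => (B.eqv p.1.1 p.1.1).and (A.eqv (f.fn p.1.1) p.2.1))
      (fun p => (B.eqv p.1.1 p.1.2).and (A.eqv p.2.1 p.2.2))
    have h2 := and_right (fun p : I => (B.eqv p.1.1 p.1.1).and (A.eqv (f.fn p.1.1) p.2.1))
      (fun p => (B.eqv p.1.1 p.1.2).and (A.eqv p.2.1 p.2.2))
    have hb := h2.trans (and_left _ _)
    refine and_intro (hb.trans (((FunRel.id B.toHTObj).strict.trans (and_right _ _)).reindex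
      fun p : I => p.1)) ?_
    have hf := hb.trans (f.eqv_le.reindex fun p : I => p.1)
    exact (and_intro (h1.trans (and_right _ _)) (and_intro hf (h2.trans (and_right _ _)))).trans
      ((FunRel.id A.toHTObj).congr.reindex
        fun p : I => ((f.fn p.1.1, f.fn p.1.2), (p.2.1, p.2.2)))
  single := by
    let I := B.carrier × A.carrier × A.carrier
    have h1 := (and_left (fun p : I => (B.eqv p.1 p.1).and (A.eqv (f.fn p.1) p.2.1))
      (fun p => (B.eqv p.1 p.1).and (A.eqv (f.fn p.1) p.2.2))).trans (and_right _ _)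
    have h2 := (and_right (fun p : I => (B.eqv p.1 p.1).and (A.eqv (f.fn p.1) p.2.1))
      (fun p => (B.eqv p.1 p.1).and (A.eqv (f.fn p.1) p.2.2))).trans (and_right _ _)
    exact (and_intro h1 h2).trans ((FunRel.id A.toHTObj).single.reindex
      fun p : I => (f.fn p.1, p.2.1, p.2.2))
  total := by
    exact ex_intro (fun b => f.fn b)
      (and_intro (refl _) (f.eqv_le.reindex fun b : B.carrier => (b, b)))

open Entails in
variable (P) in
/-- The inclusion of the Herbrand assemblies into the Herbrand topos. -/
def HAsm.toHT : HAsm P ⥤ HT P where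
  obj A := A.toHTObj
  map f := (HAsm.Hom.funRel f).hom
  map_id A := FunRel.hom_eq (and_right _ _)
  map_comp {A B C} f g := by
    refine FunRel.hom_eq (G := (HAsm.Hom.funRel f).comp (HAsm.Hom.funRel g)) ?_
    let I := A.carrier × C.carrier
    have hA := and_left (fun p : I => A.eqv p.1 p.1)
      (fun p => C.eqv (HAsm.Hom.fn g (HAsm.Hom.fn f p.1)) p.2)
    have hC := and_right (fun p : I => A.eqv p.1 p.1)
      (fun p => C.eqv (HAsm.Hom.fn g (HAsm.Hom.fn f p.1)) p.2)
    have hB := hA.trans ((HAsm.Hom.eqv_le f).reindex fun p : I => (p.1, p.1))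
    exact ex_intro (φ := fun (p : I) b => ((A.eqv p.1 p.1).and (B.eqv (HAsm.Hom.fn f p.1) b)).and
      ((B.eqv b b).and (C.eqv (HAsm.Hom.fn g b) p.2))) (fun p : I => HAsm.Hom.fn f p.1)
      (and_intro (and_intro hA hB) (and_intro hB hC))

variable (P) in
/-- The functor from sets to Herbrand assemblies sending `X` to `(X, P, φ)` with
`φ(x) = !P` for all `x`. -/
def nablaAsm : Type u ⥤ HAsm P where
  obj X :=
    { carrier := X
      pot := Set.univ
      real := fun _ => bang Set.univ
      real_sub := fun _ _ h => h
      real_nonempty := fun _ => ⟨enc [], [], by simp, rfl⟩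
      real_up := fun _ _ _ _ h _ => h }
  map f := ⟨fun x => f x, idc, fun m hm => ⟨m, by simp, hm⟩, fun _ m hm => ⟨m, by simp, hm⟩⟩
  map_id _ := rfl
  map_comp _ _ := rfl

variable (P) in
/-- The functor `∇ : Sets ⥤ HT[P]`. -/
def nabla : Type u ⥤ HT P := nablaAsm P ⋙ HAsm.toHT P

end Topos

/-! ### The structure of a locally cartesian closed pretopos -/

section Structure

variable {C : Type u₁} [Category.{v₁} C] {D : Type u₂} [Category.{v₂} D]

/-- For `g : S ⟶ B` and `f : B ⟶ A`, the object `p : T ⟶ A` over `A`, together with the evaluation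
`ev : f* T ⟶ S` over `B` (where `W = f* T`), is the dependent product `∏_f g`. -/
structure IsDependentProduct {S B A T W : C} (g : S ⟶ B) (f : B ⟶ A) (p : T ⟶ A)
    (fst : W ⟶ T) (snd : W ⟶ B) (ev : W ⟶ S) : Prop where
  isPullback : IsPullback fst snd p f
  ev_comp : ev ≫ g = snd
  existsUnique : ∀ ⦃Z V : C⦄ (h : Z ⟶ A) (q : V ⟶ Z) (r : V ⟶ B) (e : V ⟶ S),
    IsPullback q r h f → e ≫ g = r →
      ∃! t : Z ⟶ T, t ≫ p = h ∧
        ∀ w : V ⟶ W, w ≫ fst = q ≫ t → w ≫ snd = r → w ≫ ev = e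

/-- `q` is the quotient of the equivalence relation `(a, b)`. -/
structure IsQuotient {R X Q : C} (a b : R ⟶ X) (q : X ⟶ Q) : Prop where
  isEquivalenceRelation : IsEquivalenceRelation a b
  w : a ≫ q = b ≫ q
  isColimit : Nonempty (IsColimit (Cofork.ofπ q w))

/-- `F` preserves the structure of a locally cartesian closed pretopos: finite limits, finite
sums, covers (regular epimorphisms), equivalence relations and their quotients, and dependent
products with their evaluation maps. -/
structure PreservesLCCPretopos (F : C ⥤ D) : Prop where
  finiteLimits : PreservesFiniteLimits F
  finiteSums : PreservesFiniteCoproducts F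
  covers : ∀ ⦃X Y : C⦄ (f : X ⟶ Y), IsRegularEpi f → IsRegularEpi (F.map f)
  equivalenceRelations : ∀ ⦃R X : C⦄ (a b : R ⟶ X),
    IsEquivalenceRelation a b → IsEquivalenceRelation (F.map a) (F.map b)
  quotients : ∀ ⦃R X Q : C⦄ (a b : R ⟶ X) (q : X ⟶ Q),
    IsQuotient a b q → IsQuotient (F.map a) (F.map b) (F.map q)
  dependentProducts : ∀ ⦃S B A T W : C⦄ (g : S ⟶ B) (f : B ⟶ A) (p : T ⟶ A)
    (fst : W ⟶ T) (snd : W ⟶ B) (ev : W ⟶ S),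
    IsDependentProduct g f p fst snd ev →
      IsDependentProduct (F.map g) (F.map f) (F.map p) (F.map fst) (F.map snd) (F.map ev)

/-- `F` reflects the structure of a locally cartesian closed pretopos: whatever `F` sends to a
finite limit, a finite sum, a cover, an equivalence relation, a quotient of an equivalence relation
or a dependent product already is one. -/
structure ReflectsLCCPretopos (F : C ⥤ D) : Prop where
  finiteLimits : ReflectsFiniteLimits F
  finiteSums : ReflectsFiniteCoproducts F
  covers : ∀ ⦃X Y : C⦄ (f : X ⟶ Y), IsRegularEpi (F.map f) → IsRegularEpi f
  equivalenceRelations : ∀ ⦃R X : C⦄ (a b : R ⟶ X),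
    IsEquivalenceRelation (F.map a) (F.map b) → IsEquivalenceRelation a b
  quotients : ∀ ⦃R X Q : C⦄ (a b : R ⟶ X) (q : X ⟶ Q),
    IsQuotient (F.map a) (F.map b) (F.map q) → IsQuotient a b q
  dependentProducts : ∀ ⦃S B A T W : C⦄ (g : S ⟶ B) (f : B ⟶ A) (p : T ⟶ A)
    (fst : W ⟶ T) (snd : W ⟶ B) (ev : W ⟶ S),
    IsDependentProduct (F.map g) (F.map f) (F.map p) (F.map fst) (F.map snd) (F.map ev) →
      IsDependentProduct g f p fst snd ev

end Structure

/-! ### Many-sorted first-order logic -/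

/-- A many-sorted first-order signature. -/
structure Signature where
  Srt : Type w
  Fn : Type w
  dom : Fn → List Srt
  cod : Fn → Srt
  Rel : Type w
  ar : Rel → List Srt

/-- Terms in a context (a list of sorts, one for each free variable). -/
inductive Term (S : Signature.{w}) (Γ : List S.Srt) : S.Srt → Type w
  | var (i : Fin Γ.length) : Term S Γ (Γ.get i)
  | fn (f : S.Fn) (ts : ∀ i : Fin (S.dom f).length, Term S Γ ((S.dom f).get i)) :
      Term S Γ (S.cod f)

/-- First-order formulas in a context; quantifiers bind the first variable of the context. -/
inductive Formula (S : Signature.{w}) : List S.Srt → Type w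
  | bot {Γ : List S.Srt} : Formula S Γ
  | top {Γ : List S.Srt} : Formula S Γ
  | eq {Γ : List S.Srt} {s : S.Srt} (t t' : Term S Γ s) : Formula S Γ
  | rel {Γ : List S.Srt} (R : S.Rel)
      (ts : ∀ i : Fin (S.ar R).length, Term S Γ ((S.ar R).get i)) : Formula S Γ
  | and {Γ : List S.Srt} (φ ψ : Formula S Γ) : Formula S Γ
  | or {Γ : List S.Srt} (φ ψ : Formula S Γ) : Formula S Γ
  | imp {Γ : List S.Srt} (φ ψ : Formula S Γ) : Formula S Γ
  | ex {Γ : List S.Srt} (s : S.Srt) (φ : Formula S (s :: Γ)) : Formula S Γ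
  | all {Γ : List S.Srt} (s : S.Srt) (φ : Formula S (s :: Γ)) : Formula S Γ

/-- Ordinary set-valued structures. -/
structure SetStructure (S : Signature.{w}) where
  carrier : S.Srt → Type u
  fn : ∀ f : S.Fn, (∀ i : Fin (S.dom f).length, carrier ((S.dom f).get i)) → carrier (S.cod f)
  rel : ∀ R : S.Rel, Set (∀ i : Fin (S.ar R).length, carrier ((S.ar R).get i))

namespace SetStructure

variable {S : Signature.{w}} (M : SetStructure.{w, u} S)

/-- Assignments of values to the variables of a context. -/
abbrev Assignment (Γ : List S.Srt) : Type u := ∀ i : Fin Γ.length, M.carrier (Γ.get i)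

/-- The value of a term. -/
def value {Γ : List S.Srt} (v : M.Assignment Γ) : ∀ {s : S.Srt}, Term S Γ s → M.carrier s
  | _, .var i => v i
  | _, .fn f ts => M.fn f fun i => value v (ts i)

/-- Extend an assignment by a value for a new first variable. -/
def extend {Γ : List S.Srt} {s : S.Srt} (a : M.carrier s) (v : M.Assignment Γ) :
    M.Assignment (s :: Γ) :=
  Fin.cons (α := fun i : Fin (Γ.length + 1) => M.carrier ((s :: Γ).get i)) a v

/-- Tarskian satisfaction. -/
def Sat : ∀ {Γ : List S.Srt}, Formula S Γ → M.Assignment Γ → Prop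
  | _, .bot, _ => False
  | _, .top, _ => True
  | _, .eq t t', v => M.value v t = M.value v t'
  | _, .rel R ts, v => (fun i => M.value v (ts i)) ∈ M.rel R
  | _, .and φ ψ, v => Sat φ v ∧ Sat ψ v
  | _, .or φ ψ, v => Sat φ v ∨ Sat ψ v
  | _, .imp φ ψ, v => Sat φ v → Sat ψ v
  | _, .ex _ φ, v => ∃ a, Sat φ (M.extend a v)
  | _, .all _ φ, v => ∀ a, Sat φ (M.extend a v)

/-- A formula is valid in `M` if it is satisfied by all assignments. -/
def Valid {Γ : List S.Srt} (φ : Formula S Γ) : Prop := ∀ v, M.Sat φ v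

end SetStructure

/-- Structures in a category: objects interpreting the sorts, a chosen finite product for every
context, morphisms interpreting the function symbols and subobjects interpreting the relation
symbols. -/
structure CatStructure (S : Signature.{w}) (C : Type u₁) [Category.{v₁} C] where
  carrier : S.Srt → C
  ctx : List S.Srt → C
  proj : ∀ (Γ : List S.Srt) (i : Fin Γ.length), ctx Γ ⟶ carrier (Γ.get i)
  isProduct : ∀ Γ : List S.Srt, IsLimit (Fan.mk (ctx Γ) (proj Γ))
  fn : ∀ f : S.Fn, ctx (S.dom f) ⟶ carrier (S.cod f)
  rel : ∀ R : S.Rel, Subobject (ctx (S.ar R))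

namespace CatStructure

variable {S : Signature.{w}} {C : Type u₁} [Category.{v₁} C] {D : Type u₂} [Category.{v₂} D]

section

variable (N : CatStructure S C)

/-- The morphism into a context with the given components. -/
def tuple {X : C} {Γ : List S.Srt} (f : ∀ i : Fin Γ.length, X ⟶ N.carrier (Γ.get i)) :
    X ⟶ N.ctx Γ :=
  (N.isProduct Γ).lift (Fan.mk X f)

/-- The interpretation of a term. -/
def value {Γ : List S.Srt} : ∀ {s : S.Srt}, Term S Γ s → (N.ctx Γ ⟶ N.carrier s)
  | _, .var i => N.proj Γ i
  | _, .fn f ts => N.tuple (fun i => value (ts i)) ≫ N.fn f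

/-- The projection forgetting the first variable. -/
def drop (s : S.Srt) (Γ : List S.Srt) : N.ctx (s :: Γ) ⟶ N.ctx Γ :=
  N.tuple fun i => N.proj (s :: Γ) i.succ

/-- `N.Interprets φ A` says that `A` is the subobject of the context interpreting `φ`. Equality and
relation symbols are interpreted by equalizers and pullbacks, the propositional connectives by the
Heyting algebra operations on subobjects, and the quantifiers by the left and right adjoints of
pulling back along the projection. (`A` is determined uniquely by these universal properties.) -/
def Interprets : ∀ {Γ : List S.Srt}, Formula S Γ → Subobject (N.ctx Γ) → Prop
  | _, .bot, A => IsBot A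
  | _, .top, A => IsTop A
  | Γ, .eq t t', A => ∀ ⦃Z : C⦄ (z : Z ⟶ N.ctx Γ), A.Factors z ↔ z ≫ N.value t = z ≫ N.value t'
  | Γ, .rel R ts, A => ∀ ⦃Z : C⦄ (z : Z ⟶ N.ctx Γ),
      A.Factors z ↔ (N.rel R).Factors (z ≫ N.tuple fun i => N.value (ts i))
  | _, .and φ ψ, A => ∃ B B', Interprets φ B ∧ Interprets ψ B' ∧ IsGLB {B, B'} A
  | _, .or φ ψ, A => ∃ B B', Interprets φ B ∧ Interprets ψ B' ∧ IsLUB {B, B'} A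
  | _, .imp φ ψ, A => ∃ B B', Interprets φ B ∧ Interprets ψ B' ∧
      ∀ X, X ≤ A ↔ ∀ Y, Y ≤ X → Y ≤ B → Y ≤ B'
  | Γ, .ex s φ, A => ∃ B, Interprets φ B ∧
      ∀ X, A ≤ X ↔ X.Factors (B.arrow ≫ N.drop s Γ)
  | Γ, .all s φ, A => ∃ B, Interprets φ B ∧
      ∀ X, X ≤ A ↔ ∀ Y, X.Factors (Y.arrow ≫ N.drop s Γ) → Y ≤ B

/-- A formula is valid in `N` if it is interpreted by the maximal subobject. -/
def Valid {Γ : List S.Srt} (φ : Formula S Γ) : Prop := N.Interprets φ ⊤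

end

/-- The image of a structure under a functor that preserves finite limits. -/
def map (N : CatStructure S C) (F : C ⥤ D) [PreservesFiniteLimits F] : CatStructure S D where
  carrier s := F.obj (N.carrier s)
  ctx Γ := F.obj (N.ctx Γ)
  proj Γ i := F.map (N.proj Γ i)
  isProduct Γ := isLimitFanMkObjOfIsLimit F _ _ (N.isProduct Γ)
  fn f := F.map (N.fn f)
  rel R := Subobject.mk (F.map (N.rel R).arrow)

end CatStructure

/-- An ordinary structure as a structure in the category of sets. -/
def SetStructure.toCat {S : Signature.{w}} (M : SetStructure.{w, u} S) :
    CatStructure S (Type u) where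
  carrier := M.carrier
  ctx Γ := M.Assignment Γ
  proj Γ i := ↾fun v => v i
  isProduct Γ := Fan.IsLimit.mk _ (fun c => ↾fun x i => c.proj i x)
    (fun _ _ => rfl) (fun c m h => by
      ext x
      funext i
      exact ConcreteCategory.congr_hom (h i) x)
  fn f := ↾M.fn f
  rel R :=
    haveI : Mono (↾(Subtype.val : {v : M.Assignment (S.ar R) // v ∈ M.rel R} → _)) :=
      (ofHom_mono_iff_injective _).2 Subtype.val_injective
    Subobject.mk (↾(Subtype.val : {v : M.Assignment (S.ar R) // v ∈ M.rel R} → _))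
end Herbrand
end

/-!
The functor `∇` sends a set to itself with an equality predicate that carries no computational
information. Write `nab S` for the truth value `(!P, P)` or `(∅, P)`, according to whether the
proposition `S` holds; an entailment into a family of such truth values is realized by the identity
as soon as it holds on the level of truth (`Entails.to_nab`).

*Right adjointness.* A point `∇ 1 ⟶ X` of an object of the Herbrand topos amounts to an element of
`X` whose existence has an actual realizer, up to equality with an actual realizer. It follows that
a map `X ⟶ ∇ Y` is the same thing as a function from the points of `X` to `Y`
(`nabla_pointDetermined`). So `∇` is fully faithful and right adjoint to `Hom(∇ 1, -)`, which
preserves all limits. Hence `∇` preserves limits and internal equivalence relations, and it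
preserves dependent products since test diagrams can be transposed along the adjunction
(`IsDependentProduct.map`). Full faithfulness gives reflection.

*Quotients.* In sets, surjections split and quotients of equivalence relations are split
coequalizers, by the axiom of choice; these are preserved by any functor.

*Coproducts.* This is where the Herbrand tripos differs from the usual realizability tripos. The
disjunction `nab S ∨ nab T` is realized whenever `S ∨ T` is true, because an actual realizer of a
disjunction may offer both tags (`Entails.nab_or`); conversely a disjunction is eliminated by
running both cases and concatenating the results (`Entails.or_elim`). Hence the relation
`(∃ x, w = inl x ∧ F(x, z)) ∨ (∃ y, w = inr y ∧ G(y, z))` is functional, and it is the unique map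
`∇ (X ⊕ Y) ⟶ Z` with components `F` and `G`.

*Formulas.* Subobjects of `∇ X` given by subsets of `X` are closed under the operations that
interpret first-order logic: for the limit-like operations `=`, `∧`, `→`, `∀` this is checked on
points, and for `⊥`, `∨`, `∃` it follows from the preservation of coproducts and images. So the
interpretation of a formula in `∇ M` is the subobject given by the set of assignments that satisfy
it (`SetStructure.interprets_satSubobject`), and it is the maximal one iff that set is everything.
-/

noncomputable section

namespace Herbrand

/-! ### Two-valued predicates and disjunction in the Herbrand tripos -/

section Logic

variable {P : Type u} [PCA P]

/-- The two-valued predicate given by a proposition `S`: it is `(!P, P)` if `S` holds and `(∅, P)`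
otherwise. The equality predicate of `∇ X` is `nab (x = x')`, by definition. -/
def Sig.nab (S : Prop) : Sig P where
  act := {n | S ∧ n ∈ bang Set.univ}
  pot := Set.univ
  act_sub := fun _ h => h.2
  up := fun _ hm _ hn _ => ⟨hm.1, hn⟩

variable [Nontrivial P]

/-- Disjunction: a tagged sequence is actual iff one of its two parts is. -/
def Sig.or (A B : Sig P) : Sig P where
  act := {n | ∃ l : List P, n = enc l ∧ (∀ x ∈ l, x ∈ amp A.pot B.pot) ∧
    (enc (Entails.part church0 l) ∈ A.act ∨ enc (Entails.part church1 l) ∈ B.act)}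
  pot := amp A.pot B.pot
  act_sub := by
    rintro n ⟨l, rfl, h, -⟩
    exact ⟨l, h, rfl⟩
  up := by
    refine upClosed_of ?_
    rintro l l' ⟨l₁, h1, h2, h3⟩ h' hs
    obtain rfl := enc_injective h1
    refine ⟨l', rfl, h', h3.imp (fun h => ?_) (fun h => ?_)⟩
    · exact enc_mem_of_up A.up h (Entails.mem_part0 h') fun x hx =>
        Entails.mem_part.2 (hs (Entails.mem_part.1 hx))
    · exact enc_mem_of_up B.up h (Entails.mem_part1 h') fun x hx =>
        Entails.mem_part.2 (hs (Entails.mem_part.1 hx))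

theorem Sig.and_act_nonempty {A B : Sig P} :
    (A.and B).act.Nonempty ↔ A.act.Nonempty ∧ B.act.Nonempty := by
  constructor
  · rintro ⟨_, l, -, -, ⟨a, ha, -⟩, ⟨b, hb, -⟩⟩
    exact ⟨⟨_, ha⟩, ⟨_, hb⟩⟩
  · rintro ⟨⟨m, hm⟩, ⟨n, hn⟩⟩
    obtain ⟨l, -, rfl⟩ := A.act_sub hm
    obtain ⟨l', -, rfl⟩ := B.act_sub hn
    exact ⟨_, Entails.conj_act hm hn⟩

theorem Sig.ex_act_nonempty {J : Type w} {φ : J → Sig P} :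
    (Sig.ex φ).act.Nonempty ↔ ∃ j, (φ j).act.Nonempty := by
  constructor
  · rintro ⟨_, l, -, -, m, -, j, hj⟩
    exact ⟨j, m, hj⟩
  · rintro ⟨j, m, hm⟩
    refine ⟨enc [m], [m], rfl, ?_, m, List.mem_singleton_self m, j, hm⟩
    intro x hx
    obtain rfl := List.mem_singleton.1 hx
    exact ⟨j, (φ j).act_sub hm⟩

theorem Sig.nab_act_nonempty {S : Prop} : (Sig.nab S : Sig P).act.Nonempty ↔ S :=
  ⟨fun ⟨_, h⟩ => h.1, fun h => ⟨enc [], h, [], by simp, rfl⟩⟩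

namespace Entails

variable {I : Type w}

theorem act_nonempty {φ ψ : I → Sig P} (h : Entails φ ψ) {i : I} (hi : (φ i).act.Nonempty) :
    (ψ i).act.Nonempty := by
  obtain ⟨r, hr⟩ := h
  obtain ⟨n, hn⟩ := hi
  obtain ⟨m, -, hm⟩ := (hr i).2 n hn
  exact ⟨m, hm⟩

/-- Two-valued predicates carry no computational information: the identity realizes every
entailment into one that is correct on the level of truth. -/
theorem to_nab {φ : I → Sig P} {S : I → Prop} (h : ∀ i, (φ i).act.Nonempty → S i) :
    Entails φ (fun i => Sig.nab (S i)) :=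
  of_list idc id (fun _ _ _ => ⟨by simp, fun _ _ => trivial⟩)
    fun i l _ ha => ⟨h i ⟨_, ha⟩, l, fun _ _ => trivial, rfl⟩

/-- A constant sequence that is an actual realizer throughout proves the predicate. -/
theorem of_const {φ ψ : I → Sig P} (m : P) (h : ∀ i, m ∈ (ψ i).act) : Entails φ ψ :=
  ⟨k1 m, fun i => ⟨fun _ _ => ⟨m, by simp, (ψ i).act_sub (h i)⟩, fun _ _ => ⟨m, by simp, h i⟩⟩⟩

/-- A predicate without actual realizers entails everything, whatever its potential realizers:
the empty sequence is always a potential realizer. -/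
theorem of_not_act {φ ψ : I → Sig P} (h : ∀ i, ¬ (φ i).act.Nonempty) : Entails φ ψ :=
  of_list (k1 (enc [])) (fun _ => []) (fun _ _ _ => ⟨by simp, by simp⟩)
    fun i _ _ ha => (h i ⟨_, ha⟩).elim

/-- Existential quantification of two-valued predicates over a fixed set needs no witness: all
disjuncts share their realizers. -/
theorem nab_ex {J : Type v₁} {S : I → J → Prop} : Entails
    (fun i => (Sig.nab (∃ j, S i j) : Sig P)) (fun i => Sig.ex fun j => Sig.nab (S i j)) := by
  -- For empty `J` the only potential realizer on the right is the empty sequence.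
  rcases isEmpty_or_nonempty J with hJ | ⟨⟨j₀⟩⟩
  · exact of_not_act fun i hi => hJ.elim (Sig.nab_act_nonempty.1 hi).choose
  · refine of_list (k1 (enc [enc []])) (fun _ => [enc []]) (fun i _ _ => ⟨by simp, ?_⟩) ?_
    · intro a ha
      obtain rfl := List.mem_singleton.1 ha
      exact ⟨j₀, mem_bang.2 (by simp)⟩
    · rintro i l - ⟨⟨j, hj⟩, -⟩
      refine ⟨_, rfl, ?_, _, List.mem_singleton_self _, j, hj, mem_bang.2 (by simp)⟩
      intro a ha
      obtain rfl := List.mem_singleton.1 ha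
      exact ⟨j, mem_bang.2 (by simp)⟩

theorem or_left {φ ψ : I → Sig P} : Entails φ (fun i => (φ i).or (ψ i)) := by
  obtain ⟨r, hr⟩ := exists_tag (church0 : P)
  have hp : ∀ i, ∀ l : List P, (∀ a ∈ l, a ∈ (φ i).pot) →
      ∀ x ∈ l.map (pair church0), x ∈ amp (φ i).pot (ψ i).pot := by
    intro i l hl x hx
    obtain ⟨a, ha, rfl⟩ := List.mem_map.1 hx
    exact Or.inl ⟨a, hl a ha, rfl⟩
  refine of_list r (fun l => l.map (pair church0)) (fun i l hl => ⟨hr l, hp i l hl⟩) ?_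
  intro i l hl ha
  exact ⟨_, rfl, hp i l hl, Or.inl (enc_mem_of_up (φ i).up ha (mem_part0 (hp i l hl))
    fun x hx => mem_part.2 (List.mem_map_of_mem hx))⟩

theorem or_right {φ ψ : I → Sig P} : Entails ψ (fun i => (φ i).or (ψ i)) := by
  obtain ⟨r, hr⟩ := exists_tag (church1 : P)
  have hp : ∀ i, ∀ l : List P, (∀ a ∈ l, a ∈ (ψ i).pot) →
      ∀ x ∈ l.map (pair church1), x ∈ amp (φ i).pot (ψ i).pot := by
    intro i l hl x hx
    obtain ⟨a, ha, rfl⟩ := List.mem_map.1 hx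
    exact Or.inr ⟨a, hl a ha, rfl⟩
  refine of_list r (fun l => l.map (pair church1)) (fun i l hl => ⟨hr l, hp i l hl⟩) ?_
  intro i l hl ha
  exact ⟨_, rfl, hp i l hl, Or.inr (enc_mem_of_up (ψ i).up ha (mem_part1 (hp i l hl))
    fun x hx => mem_part.2 (List.mem_map_of_mem hx))⟩

/-- Two candidate realizers, both defined on all potential realizers, one of which is correct on
every actual one, can be merged by concatenating their values. -/
theorem of_append {φ ψ : I → Sig P} (r r' : P) (F F' : List P → List P)
    (h1 : ∀ i, ∀ l : List P, (∀ a ∈ l, a ∈ (φ i).pot) →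
      app r (enc l) = Part.some (enc (F l)) ∧ ∀ a ∈ F l, a ∈ (ψ i).pot)
    (h2 : ∀ i, ∀ l : List P, (∀ a ∈ l, a ∈ (φ i).pot) →
      app r' (enc l) = Part.some (enc (F' l)) ∧ ∀ a ∈ F' l, a ∈ (ψ i).pot)
    (h : ∀ i, ∀ l : List P, (∀ a ∈ l, a ∈ (φ i).pot) → enc l ∈ (φ i).act →
      enc (F l) ∈ (ψ i).act ∨ enc (F' l) ∈ (ψ i).act) : Entails φ ψ := by
  obtain ⟨ap, hap⟩ := exists_append (P := P)
  let t : Tm P := .app (.app (.const ap) (.app (.const r') (.var 0))) (.app (.const r) (.var 0))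
  have hp : ∀ i, ∀ l : List P, (∀ a ∈ l, a ∈ (φ i).pot) →
      ∀ a ∈ F l ++ F' l, a ∈ (ψ i).pot := fun i l hl a ha =>
    (List.mem_append.1 ha).elim ((h1 i l hl).2 a) ((h2 i l hl).2 a)
  refine of_list (t.lamVal fun _ => idc) (fun l => F l ++ F' l)
    (fun i l hl => ⟨?_, hp i l hl⟩) ?_
  · obtain ⟨Rm, h3, h4⟩ := hap (F' l)
    simp [Tm.app_lamVal, t, Tm.eval, push, (h1 i l hl).1, (h2 i l hl).1, h3, h4]
  · intro i l hl ha
    rcases h i l hl ha with h' | h'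
    · exact enc_mem_of_up (ψ i).up h' (hp i l hl) (List.subset_append_left _ _)
    · exact enc_mem_of_up (ψ i).up h' (hp i l hl) (List.subset_append_right _ _)

/-- Elimination of disjunction, with a side condition `χ`. Which disjunct is actual cannot be
computed, so both cases are run and the results are concatenated. -/
theorem or_elim {χ φ φ' ψ : I → Sig P} (h : Entails (fun i => (χ i).and (φ i)) ψ)
    (h' : Entails (fun i => (χ i).and (φ' i)) ψ) :
    Entails (fun i => (χ i).and ((φ i).or (φ' i))) ψ := by
  obtain ⟨r, F, h1, h2⟩ := h.exists_list
  obtain ⟨r', F', h1', h2'⟩ := h'.exists_list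
  obtain ⟨c, hc⟩ := exists_conj (P := P)
  obtain ⟨q0, hq0⟩ := exists_part0 (P := P)
  obtain ⟨q1, hq1⟩ := exists_part1 (P := P)
  let t : Tm P := .app (.const r) (.app (.app (.const c) (.app (.const q0) (.var 0)))
    (.app (.const q0) (.app (.const q1) (.var 0))))
  let t' : Tm P := .app (.const r') (.app (.app (.const c) (.app (.const q0) (.var 0)))
    (.app (.const q1) (.app (.const q1) (.var 0))))
  refine of_append (t.lamVal fun _ => idc) (t'.lamVal fun _ => idc)
    (fun l => F (conj (part church0 l) (part church0 (part church1 l))))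
    (fun l => F' (conj (part church0 l) (part church1 (part church1 l)))) ?_ ?_ ?_
  · intro i l hl
    have hl1 := mem_part1 hl
    obtain ⟨e, he⟩ := h1 i _ (conj_pot (mem_part0 hl) (mem_part0 hl1))
    refine ⟨?_, he⟩
    have e0 := hq0 l fun x hx => amp_mono (hl x hx)
    have e1 := hq1 l fun x hx => amp_mono (hl x hx)
    have e2 := hq0 (part church1 l) fun x hx => amp_mono (hl1 x hx)
    rw [Tm.app_lamVal]
    simp only [t, Tm.eval, push, papp_some, e0, e1, e2, hc, e]
  · intro i l hl
    have hl1 := mem_part1 hl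
    obtain ⟨e, he⟩ := h1' i _ (conj_pot (mem_part0 hl) (mem_part1 hl1))
    refine ⟨?_, he⟩
    have e0 := hq0 l fun x hx => amp_mono (hl x hx)
    have e1 := hq1 l fun x hx => amp_mono (hl x hx)
    have e2 := hq1 (part church1 l) fun x hx => amp_mono (hl1 x hx)
    rw [Tm.app_lamVal]
    simp only [t', Tm.eval, push, papp_some, e0, e1, e2, hc, e]
  · rintro i l hl ⟨l', e, -, ⟨a, ha, hal⟩, ⟨b, ⟨b', eb, hb, hor⟩, hbl⟩⟩
    obtain rfl := enc_injective e
    obtain rfl := enc_injective eb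
    have hl0 := mem_part0 hl
    have hl1 := mem_part1 hl
    have hχ : enc (part church0 l) ∈ (χ i).act :=
      enc_mem_of_up (χ i).up ha hl0 fun x hx => mem_part.2 (hal x hx)
    have hs : b ⊆ part church1 l := fun x hx => mem_part.2 (hbl x hx)
    refine hor.imp (fun hφ => h2 i _ (conj_pot hl0 (mem_part0 hl1)) (conj_act hχ ?_))
      (fun hφ => h2' i _ (conj_pot hl0 (mem_part1 hl1)) (conj_act hχ ?_))
    · exact enc_mem_of_up (φ i).up hφ (mem_part0 hl1) fun x hx =>
        mem_part.2 (hs (mem_part.1 hx))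
    · exact enc_mem_of_up (φ' i).up hφ (mem_part1 hl1) fun x hx =>
        mem_part.2 (hs (mem_part.1 hx))

/-- Excluded middle for two-valued predicates: both tags are offered. -/
theorem nab_or {φ : I → Sig P} {S T : I → Prop} (h : ∀ i, S i ∨ T i) :
    Entails φ (fun i => (Sig.nab (S i)).or (Sig.nab (T i))) := by
  refine of_const (enc (conj [enc []] [enc []])) fun i =>
    ⟨_, rfl, conj_pot (fun _ _ => trivial) (fun _ _ => trivial), (h i).imp (fun h => ⟨h, ?_⟩)
      fun h => ⟨h, ?_⟩⟩
  all_goals exact mem_bang.2 fun _ _ => trivial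

end Entails

end Logic

/-! ### Points of objects of the Herbrand topos -/

/-- Points `F 1 ⟶ Z` behave, as far as maps into objects `F Y` are concerned, like the elements of
a set: a map `Z ⟶ F Y` is the same thing as a function from the points of `Z` to `Y`. In other
words, `F` is fully faithful and right adjoint to `Hom(F 1, -)`. -/
structure PointDetermined {D : Type u₂} [Category.{v₂} D] (F : Type u ⥤ D) : Prop where
  existsUnique_point : ∀ {Y : Type u} (p : F.obj PUnit ⟶ F.obj Y),
    ∃! y : Y, F.map (↾fun _ : PUnit => y) = p
  hom_ext : ∀ {Z : D} {Y : Type u} {f g : Z ⟶ F.obj Y},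
    (∀ p : F.obj PUnit ⟶ Z, p ≫ f = p ≫ g) → f = g
  exists_hom : ∀ {Z : D} {Y : Type u} (g : (F.obj PUnit ⟶ Z) → Y),
    ∃ f : Z ⟶ F.obj Y, ∀ p, p ≫ f = F.map (↾fun _ : PUnit => g p)

section Points

variable {P : Type u} [PCA P] [Nontrivial P]

open Entails

theorem FunRel.le_of_hom_eq {X Y : HT P} {F G : FunRel X Y} (h : F.hom = G.hom) : F.LE G :=
  (Quotient.exact h).1

theorem HT.exists_hom_eq {X Y : HT P} (f : X ⟶ Y) : ∃ F : FunRel X Y, F.hom = f :=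
  Quotient.exists_rep f

theorem HT.act_symm {X : HT P} {x y : X.carrier} (h : (X.eq x y).act.Nonempty) :
    (X.eq y x).act.Nonempty :=
  act_nonempty X.symm (i := (x, y)) h

/-- Equality statements on `∇ Y` are entailed as soon as they are true. -/
theorem Entails.to_nabla_eq {I : Type w} {Y : Type u} {φ : I → Sig P} (f g : I → Y)
    (h : ∀ i, (φ i).act.Nonempty → f i = g i) :
    Entails φ (fun i => ((nabla P).obj Y).eq (f i) (g i)) :=
  to_nab h

/-- The point of `X` given by an element whose existence has an actual realizer. -/
def FunRel.point (X : HT P) (x : X.carrier) (h : (X.eq x x).act.Nonempty) :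
    FunRel ((nabla P).obj PUnit) X where
  rel _ y := X.eq x y
  strict := and_intro (to_nabla_eq (Y := PUnit.{u + 1}) _ _ fun _ _ => rfl)
    (((FunRel.id X).strict.trans (and_right _ _)).reindex
      fun p : PUnit.{u + 1} × X.carrier => (x, p.2))
  congr := (and_intro (and_left _ _) ((and_right _ _).trans (and_right _ _))).trans
    (X.trans.reindex fun p : (PUnit.{u + 1} × PUnit.{u + 1}) × (X.carrier × X.carrier) =>
      (x, p.2.1, p.2.2))
  single := (FunRel.id X).single.reindex
    fun p : PUnit.{u + 1} × X.carrier × X.carrier => (x, p.2.1, p.2.2)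
  total := by
    obtain ⟨m, hm⟩ := Sig.ex_act_nonempty.2 ⟨x, h⟩
    exact of_const m fun _ => hm

theorem FunRel.point_eq {X : HT P} {x x' : X.carrier} (h : (X.eq x x).act.Nonempty)
    (h' : (X.eq x' x').act.Nonempty) (hx : (X.eq x x').act.Nonempty) :
    (FunRel.point X x h).hom = (FunRel.point X x' h').hom := by
  obtain ⟨m, hm⟩ := HT.act_symm hx
  -- `X.eq x' x` does not depend on the index, so one actual realizer proves it uniformly.
  exact FunRel.hom_eq ((and_intro (of_const (ψ := fun _ => X.eq x' x) m fun _ => hm)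
    (refl _)).trans (X.trans.reindex fun p : PUnit.{u + 1} × X.carrier => (x', x, p.2)))

/-- Totality of a functional relation on `∇ 1` yields an actual realizer at some element, and this
element determines the relation. -/
theorem FunRel.exists_point_eq {X : HT P} (p : (nabla P).obj PUnit ⟶ X) :
    ∃ (x : X.carrier) (h : (X.eq x x).act.Nonempty), (FunRel.point X x h).hom = p := by
  obtain ⟨F, rfl⟩ := HT.exists_hom_eq p
  obtain ⟨x, m, hm⟩ := Sig.ex_act_nonempty.1 (act_nonempty F.total (i := PUnit.unit)
    (Sig.nab_act_nonempty.2 rfl))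
  have h := (Sig.and_act_nonempty.1
    (act_nonempty F.strict (i := (PUnit.unit, x)) ⟨m, hm⟩)).2
  refine ⟨x, h, (FunRel.hom_eq ?_).symm⟩
  exact (and_intro (of_const (ψ := fun _ => F.rel PUnit.unit x) m fun _ => hm)
    (refl _)).trans (F.single.reindex fun p : PUnit.{u + 1} × X.carrier => (p.1, x, p.2))

theorem FunRel.act_of_point_comp_eq {X Y : HT P} {F G : FunRel X Y} {x : X.carrier}
    {h : (X.eq x x).act.Nonempty}
    (e : (FunRel.point X x h).hom ≫ F.hom = (FunRel.point X x h).hom ≫ G.hom) {y : Y.carrier}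
    (hy : (F.rel x y).act.Nonempty) : (G.rel x y).act.Nonempty := by
  have hle : ((FunRel.point X x h).comp F).LE ((FunRel.point X x h).comp G) :=
    FunRel.le_of_hom_eq e
  obtain ⟨x', hx'⟩ := Sig.ex_act_nonempty.1 (act_nonempty hle (i := (PUnit.unit, y))
    (Sig.ex_act_nonempty.2 ⟨x, Sig.and_act_nonempty.2 ⟨h, hy⟩⟩))
  obtain ⟨h1, h2⟩ := Sig.and_act_nonempty.1 hx'
  have hyy := (Sig.and_act_nonempty.1 (act_nonempty F.strict (i := (x, y)) hy)).2
  exact act_nonempty G.congr (i := ((x', x), (y, y)))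
    (Sig.and_act_nonempty.2 ⟨h2, Sig.and_act_nonempty.2 ⟨HT.act_symm h1, hyy⟩⟩)

theorem nabla_hom_ext {X : HT P} {Y : Type u} {f g : X ⟶ (nabla P).obj Y}
    (h : ∀ p : (nabla P).obj PUnit ⟶ X, p ≫ f = p ≫ g) : f = g := by
  obtain ⟨F, rfl⟩ := HT.exists_hom_eq f
  obtain ⟨G, rfl⟩ := HT.exists_hom_eq g
  refine FunRel.hom_eq ?_
  have hx := F.strict.trans (and_left _ _)
  refine (and_intro (refl _) (hx.trans (G.total.reindex Prod.fst))).trans (ex_elim ?_)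
  let J := (X.carrier × Y) × Y
  have hF := and_left (fun p : J => F.rel p.1.1 p.1.2) (fun p => G.rel p.1.1 p.2)
  have hG := and_right (fun p : J => F.rel p.1.1 p.1.2) (fun p => G.rel p.1.1 p.2)
  refine (and_intro hG (and_intro (hF.trans (hx.reindex Prod.fst))
    (to_nabla_eq (fun p : J => p.2) (fun p : J => p.1.2) ?_))).trans
    (G.congr.reindex fun p : J => ((p.1.1, p.1.1), (p.2, p.1.2)))
  rintro ⟨⟨x, y⟩, y'⟩ ha
  obtain ⟨h1, h2⟩ := Sig.and_act_nonempty.1 ha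
  have hxx := (Sig.and_act_nonempty.1 (act_nonempty F.strict (i := (x, y)) h1)).1
  have h3 := FunRel.act_of_point_comp_eq (h (FunRel.point X x hxx).hom) h1
  exact Sig.nab_act_nonempty.1 (act_nonempty G.single (i := (x, y', y))
    (Sig.and_act_nonempty.2 ⟨h2, h3⟩))

/-- The functional relation to `∇ Y` given by a function on points. -/
def FunRel.ofPoints {X : HT P} {Y : Type u} (g : ((nabla P).obj PUnit ⟶ X) → Y) :
    FunRel X ((nabla P).obj Y) where
  rel x y := (X.eq x x).and (Sig.nab (∃ h, g (FunRel.point X x h).hom = y))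
  strict := and_intro (and_left _ _) (to_nabla_eq (Y := Y) _ _ fun _ _ => rfl)
  congr := by
    refine and_intro (((and_right _ _).trans (and_left _ _)).trans
      (((FunRel.id X).strict.trans (and_right _ _)).reindex
        fun p : (X.carrier × X.carrier) × (Y × Y) => p.1)) (to_nab ?_)
    rintro ⟨⟨x, x'⟩, ⟨y, y'⟩⟩ h
    simp only [Sig.and_act_nonempty, Sig.nab_act_nonempty] at h
    obtain ⟨⟨-, hx, hg⟩, hxx, hy⟩ := h
    have hy' : y = y' := Sig.nab_act_nonempty.1 hy
    have hx' := (Sig.and_act_nonempty.1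
      (act_nonempty (FunRel.id X).strict (i := (x, x')) hxx)).2
    exact ⟨hx', (congrArg g (FunRel.point_eq hx hx' hxx).symm).trans (hg.trans hy')⟩
  single := to_nab fun p h => by
    simp only [Sig.and_act_nonempty, Sig.nab_act_nonempty] at h
    obtain ⟨⟨-, _, h1⟩, -, _, h2⟩ := h
    exact h1.symm.trans h2
  total := by
    -- The witness must be given also at elements without actual realizers of their existence,
    -- which is impossible for empty `Y`; but then there are no other elements.
    rcases isEmpty_or_nonempty Y with hY | ⟨⟨y₀⟩⟩
    · exact of_not_act fun x hx => hY.elim (g (FunRel.point X x hx).hom)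
    · have hk : ∀ x, ∃ y, ∀ h, g (FunRel.point X x h).hom = y := fun x => by
        by_cases h : (X.eq x x).act.Nonempty
        · exact ⟨g (FunRel.point X x h).hom, fun _ => rfl⟩
        · exact ⟨y₀, fun h' => (h h').elim⟩
      choose k hk using hk
      exact ex_intro k (and_intro (refl _) (to_nab fun x hx => ⟨hx, hk x hx⟩))

theorem FunRel.point_comp_ofPoints {X : HT P} {Y : Type u}
    (g : ((nabla P).obj PUnit ⟶ X) → Y) (p : (nabla P).obj PUnit ⟶ X) :
    p ≫ (FunRel.ofPoints g).hom = (nabla P).map (↾fun _ : PUnit => g p) := by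
  obtain ⟨x, h, rfl⟩ := FunRel.exists_point_eq p
  have ⟨m, hm⟩ := h
  refine (FunRel.hom_eq (F := HAsm.Hom.funRel ((nablaAsm P).map _))
    (G := (FunRel.point X x h).comp (FunRel.ofPoints g)) ?_).symm
  refine ex_intro (φ := fun (p : PUnit.{u + 1} × Y) x' => (X.eq x x').and
    ((X.eq x' x').and (Sig.nab (∃ h', g (FunRel.point X x' h').hom = p.2)))) (fun _ => x)
    (and_intro (of_const m fun _ => hm) (and_intro (of_const m fun _ => hm) (to_nab ?_)))
  rintro ⟨_, y⟩ ha
  exact ⟨h, Sig.nab_act_nonempty.1 (Sig.and_act_nonempty.1 ha).2⟩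

theorem nabla_pointDetermined : PointDetermined (nabla P) where
  existsUnique_point {Y} p := by
    obtain ⟨y, h, rfl⟩ := FunRel.exists_point_eq p
    have e : ∀ y' : Y, (nabla P).map (↾fun _ : PUnit => y') = (FunRel.point ((nabla P).obj Y) y'
        (Sig.nab_act_nonempty.2 rfl)).hom := fun y' => FunRel.hom_eq (and_right _ _)
    refine ⟨y, e y, fun y' hy' => ?_⟩
    have hle := FunRel.le_of_hom_eq ((e y').symm.trans hy')
    exact (Sig.nab_act_nonempty.1 (act_nonempty hle (i := (PUnit.unit, y'))
      (Sig.nab_act_nonempty.2 rfl))).symm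
  hom_ext := nabla_hom_ext
  exists_hom g := ⟨_, FunRel.point_comp_ofPoints g⟩

end Points

/-! ### Coproducts of sets in the Herbrand topos -/

section Coproducts

variable {P : Type u} [PCA P] [Nontrivial P]

open Entails

/-- Equal elements may be substituted in a functional relation on `∇ X`: their equality has no
computational content, so it suffices that it is true. -/
theorem FunRel.nabla_subst {X : Type u} {Z : HT P} (F : FunRel ((nabla P).obj X) Z) {I : Type w}
    {χ : I → Sig P} (x x' : I → X) (z : I → Z.carrier)
    (hx : ∀ i, (χ i).act.Nonempty → x i = x' i)
    (h : Entails χ (fun i => F.rel (x i) (z i))) : Entails χ (fun i => F.rel (x' i) (z i)) :=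
  (and_intro h (and_intro (to_nabla_eq x x' hx) (h.trans ((F.strict.trans (and_right _ _)).reindex
    fun i => (x i, z i))))).trans (F.congr.reindex fun i => ((x i, x' i), (z i, z i)))

/-- Two maps out of `∇ W` that agree on the image of `h : X ⟶ W` entail each other there. -/
theorem FunRel.le_on_range {X W : Type u} {Z : HT P} (h : X ⟶ W)
    (F G : FunRel ((nabla P).obj W) Z) (e : (nabla P).map h ≫ F.hom = (nabla P).map h ≫ G.hom) :
    Entails (fun p : W × Z.carrier => (F.rel p.1 p.2).and (Sig.nab (∃ x, p.1 = h x)))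
      (fun p => G.rel p.1 p.2) := by
  have hle : ((HAsm.Hom.funRel ((nablaAsm P).map h)).comp F).LE
    ((HAsm.Hom.funRel ((nablaAsm P).map h)).comp G) := FunRel.le_of_hom_eq e
  refine (and_intro (and_left _ _) ((and_right _ _).trans nab_ex)).trans (ex_elim ?_)
  let J := (W × Z.carrier) × X
  have hF := F.nabla_subst (χ := fun p : J => (F.rel p.1.1 p.1.2).and (Sig.nab (p.1.1 = h p.2)))
    (fun p => p.1.1) (fun p => h p.2) (fun p => p.1.2)
    (fun p hp => Sig.nab_act_nonempty.1 (Sig.and_act_nonempty.1 hp).2) (and_left _ _)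
  have hF' := ex_intro (φ := fun (p : J) w => (HAsm.Hom.funRel ((nablaAsm P).map h)).rel p.2 w
    |>.and (F.rel w p.1.2)) (fun p : J => h p.2)
    (and_intro (and_intro (to_nab fun _ _ => rfl) (to_nab fun _ _ => rfl)) hF)
  refine (and_intro (and_right _ _)
    (hF'.trans (Entails.reindex hle fun p : J => (p.2, p.1.2)))).trans (ex_elim ?_)
  refine G.nabla_subst (fun p : J × W => p.2) (fun p => p.1.1.1) (fun p => p.1.1.2) ?_
    ((and_right _ _).trans (and_right _ _))
  rintro ⟨⟨⟨w, z⟩, x⟩, w'⟩ ha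
  obtain ⟨h1, h2⟩ := Sig.and_act_nonempty.1 ha
  have h3 : h x = w' :=
    Sig.nab_act_nonempty.1 (Sig.and_act_nonempty.1 (Sig.and_act_nonempty.1 h2).1).2
  exact h3.symm.trans (Sig.nab_act_nonempty.1 h1).symm

/-- The inclusions `∇ X ⟶ ∇ (X ⊕ Y)` and `∇ Y ⟶ ∇ (X ⊕ Y)` are jointly epic. -/
theorem nabla_sum_hom_ext {X Y : Type u} {Z : HT P} {f g : (nabla P).obj (X ⊕ Y) ⟶ Z}
    (hl : (nabla P).map (↾(Sum.inl : X → X ⊕ Y)) ≫ f = (nabla P).map (↾Sum.inl) ≫ g)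
    (hr : (nabla P).map (↾(Sum.inr : Y → X ⊕ Y)) ≫ f = (nabla P).map (↾Sum.inr) ≫ g) :
    f = g := by
  obtain ⟨F, rfl⟩ := HT.exists_hom_eq f
  obtain ⟨G, rfl⟩ := HT.exists_hom_eq g
  refine FunRel.hom_eq ((and_intro (refl _) (nab_or ?_)).trans
    (or_elim (F.le_on_range _ G hl) (F.le_on_range _ G hr)))
  rintro ⟨x | y, z⟩
  · exact Or.inl ⟨x, rfl⟩
  · exact Or.inr ⟨y, rfl⟩

section Copair

variable {X Y : Type u} {Z : HT P} (F : FunRel ((nabla P).obj X) Z)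
  (G : FunRel ((nabla P).obj Y) Z)

/-- The relation `(∃ x, w = inl x ∧ F(x, z)) ∨ (∃ y, w = inr y ∧ G(y, z))`. -/
def FunRel.copairRel (w : X ⊕ Y) (z : Z.carrier) : Sig P :=
  (Sig.ex fun x : X => (Sig.nab (w = Sum.inl x)).and (F.rel x z)).or
    (Sig.ex fun y : Y => (Sig.nab (w = Sum.inr y)).and (G.rel y z))

variable {I : Type w} {χ ψ : I → Sig P} {F G}

theorem FunRel.copairRel_inl {w : I → X ⊕ Y} {z : I → Z.carrier} (x : I → X)
    (hw : ∀ i, (χ i).act.Nonempty → w i = Sum.inl (x i))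
    (h : Entails χ (fun i => F.rel (x i) (z i))) :
    Entails χ (fun i => F.copairRel G (w i) (z i)) :=
  (ex_intro (φ := fun i x => (Sig.nab (w i = Sum.inl x)).and (F.rel x (z i))) x
    (and_intro (to_nab hw) h)).trans or_left

theorem FunRel.copairRel_inr {w : I → X ⊕ Y} {z : I → Z.carrier} (y : I → Y)
    (hw : ∀ i, (χ i).act.Nonempty → w i = Sum.inr (y i))
    (h : Entails χ (fun i => G.rel (y i) (z i))) :
    Entails χ (fun i => F.copairRel G (w i) (z i)) :=
  (ex_intro (φ := fun i y => (Sig.nab (w i = Sum.inr y)).and (G.rel y (z i))) y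
    (and_intro (to_nab hw) h)).trans or_right

theorem FunRel.copairRel_elim (w : I → X ⊕ Y) (z : I → Z.carrier)
    (hF : Entails (fun p : I × X => (χ p.1).and
      ((Sig.nab (w p.1 = Sum.inl p.2)).and (F.rel p.2 (z p.1)))) (fun p => ψ p.1))
    (hG : Entails (fun p : I × Y => (χ p.1).and
      ((Sig.nab (w p.1 = Sum.inr p.2)).and (G.rel p.2 (z p.1)))) (fun p => ψ p.1)) :
    Entails (fun i => (χ i).and (F.copairRel G (w i) (z i))) ψ :=
  or_elim (ex_elim hF) (ex_elim hG)

theorem FunRel.copairRel_strict (F : FunRel ((nabla P).obj X) Z) (G : FunRel ((nabla P).obj Y) Z) :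
    Entails (fun p : (X ⊕ Y) × Z.carrier => F.copairRel G p.1 p.2) (fun p => Z.eq p.2 p.2) := by
  refine (and_intro (refl _) (refl _)).trans (copairRel_elim (F := F) (G := G)
    (χ := fun p : (X ⊕ Y) × Z.carrier => F.copairRel G p.1 p.2)
    (fun p => p.1) (fun p => p.2) ?_ ?_)
  · exact ((and_right _ _).trans (and_right _ _)).trans ((F.strict.trans (and_right _ _)).reindex
      fun p : ((X ⊕ Y) × Z.carrier) × X => (p.2, p.1.2))
  · exact ((and_right _ _).trans (and_right _ _)).trans ((G.strict.trans (and_right _ _)).reindex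
      fun p : ((X ⊕ Y) × Z.carrier) × Y => (p.2, p.1.2))

theorem FunRel.copairRel_congr (F : FunRel ((nabla P).obj X) Z) (G : FunRel ((nabla P).obj Y) Z) :
    Entails (fun p : ((X ⊕ Y) × (X ⊕ Y)) × (Z.carrier × Z.carrier) =>
      (F.copairRel G p.1.1 p.2.1).and ((Sig.nab (p.1.1 = p.1.2)).and (Z.eq p.2.1 p.2.2)))
    (fun p => F.copairRel G p.1.2 p.2.2) := by
  let I := ((X ⊕ Y) × (X ⊕ Y)) × (Z.carrier × Z.carrier)
  refine (and_intro (and_right _ _) (and_left _ _)).trans (copairRel_elim (F := F) (G := G)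
    (χ := fun p : I => (Sig.nab (p.1.1 = p.1.2)).and (Z.eq p.2.1 p.2.2))
    (fun p : I => p.1.1) (fun p => p.2.1) ?_ ?_)
  · refine copairRel_inl (fun p : I × X => p.2) (fun p h => ?_) ((and_intro
      ((and_right _ _).trans (and_right _ _)) (and_intro
        (to_nabla_eq (fun p : I × X => p.2) (fun p => p.2) fun _ _ => rfl)
        ((and_left _ _).trans (and_right _ _)))).trans
      (F.congr.reindex fun p : I × X => ((p.2, p.2), (p.1.2.1, p.1.2.2))))
    simp only [Sig.and_act_nonempty, Sig.nab_act_nonempty] at h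
    exact h.1.1.symm.trans h.2.1
  · refine copairRel_inr (fun p : I × Y => p.2) (fun p h => ?_) ((and_intro
      ((and_right _ _).trans (and_right _ _)) (and_intro
        (to_nabla_eq (fun p : I × Y => p.2) (fun p => p.2) fun _ _ => rfl)
        ((and_left _ _).trans (and_right _ _)))).trans
      (G.congr.reindex fun p : I × Y => ((p.2, p.2), (p.1.2.1, p.1.2.2))))
    simp only [Sig.and_act_nonempty, Sig.nab_act_nonempty] at h
    exact h.1.1.symm.trans h.2.1

/-- If both values come from the same summand, they are equal because `F` and `G` are single-valued;
the mixed cases are contradictory. -/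
theorem FunRel.copairRel_single (F : FunRel ((nabla P).obj X) Z) (G : FunRel ((nabla P).obj Y) Z) :
    Entails (fun p : (X ⊕ Y) × Z.carrier × Z.carrier =>
      (F.copairRel G p.1 p.2.1).and (F.copairRel G p.1 p.2.2)) (fun p => Z.eq p.2.1 p.2.2) := by
  let I := (X ⊕ Y) × Z.carrier × Z.carrier
  refine copairRel_elim (F := F) (G := G) (χ := fun p : I => F.copairRel G p.1 p.2.1)
    (fun p : I => p.1) (fun p => p.2.2) ?_ ?_
  · refine (and_intro (and_right _ _) (and_left _ _)).trans (copairRel_elim (F := F) (G := G)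
      (χ := fun p : I × X => (Sig.nab (p.1.1 = Sum.inl p.2)).and (F.rel p.2 p.1.2.2))
      (fun p : I × X => p.1.1) (fun p => p.1.2.1) ?_ ?_)
    · refine (and_intro (F.nabla_subst (fun p : (I × X) × X => p.2) (fun p => p.1.2)
        (fun p => p.1.1.2.1) ?_ ((and_right _ _).trans (and_right _ _)))
        ((and_left _ _).trans (and_right _ _))).trans
        (F.single.reindex fun p : (I × X) × X => (p.1.2, p.1.1.2.1, p.1.1.2.2))
      rintro p h
      simp only [Sig.and_act_nonempty, Sig.nab_act_nonempty] at h
      exact Sum.inl_injective (h.2.1.symm.trans h.1.1)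
    · refine of_not_act fun p h => ?_
      simp only [Sig.and_act_nonempty, Sig.nab_act_nonempty] at h
      exact Sum.inl_ne_inr (h.1.1.symm.trans h.2.1)
  · refine (and_intro (and_right _ _) (and_left _ _)).trans (copairRel_elim (F := F) (G := G)
      (χ := fun p : I × Y => (Sig.nab (p.1.1 = Sum.inr p.2)).and (G.rel p.2 p.1.2.2))
      (fun p : I × Y => p.1.1) (fun p => p.1.2.1) ?_ ?_)
    · refine of_not_act fun p h => ?_
      simp only [Sig.and_act_nonempty, Sig.nab_act_nonempty] at h
      exact Sum.inl_ne_inr (h.2.1.symm.trans h.1.1)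
    · refine (and_intro (G.nabla_subst (fun p : (I × Y) × Y => p.2) (fun p => p.1.2)
        (fun p => p.1.1.2.1) ?_ ((and_right _ _).trans (and_right _ _)))
        ((and_left _ _).trans (and_right _ _))).trans
        (G.single.reindex fun p : (I × Y) × Y => (p.1.2, p.1.1.2.1, p.1.1.2.2))
      rintro p h
      simp only [Sig.and_act_nonempty, Sig.nab_act_nonempty] at h
      exact Sum.inr_injective (h.2.1.symm.trans h.1.1)

theorem FunRel.copairRel_total (F : FunRel ((nabla P).obj X) Z) (G : FunRel ((nabla P).obj Y) Z) :
    Entails (fun w : X ⊕ Y => (Sig.nab (w = w) : Sig P)) (fun w => Sig.ex (F.copairRel G w)) := by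
  refine (and_intro (refl _) (nab_or (S := fun w : X ⊕ Y => ∃ x, w = Sum.inl x)
    (T := fun w => ∃ y, w = Sum.inr y) ?_)).trans (or_elim ?_ ?_)
  · rintro (x | y)
    · exact Or.inl ⟨x, rfl⟩
    · exact Or.inr ⟨y, rfl⟩
  · refine ((and_right _ _).trans nab_ex).trans (ex_elim' ?_)
    refine (and_intro (refl _) ((to_nabla_eq (fun p : (X ⊕ Y) × X => p.2) (fun p => p.2)
      fun _ _ => rfl).trans (F.total.reindex fun p : (X ⊕ Y) × X => p.2))).trans (ex_elim ?_)
    refine ex_intro (fun p : ((X ⊕ Y) × X) × Z.carrier => p.2) (copairRel_inl (fun p => p.1.2)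
      (fun p h => ?_) (and_right _ _))
    simp only [Sig.and_act_nonempty, Sig.nab_act_nonempty] at h
    exact h.1
  · refine ((and_right _ _).trans nab_ex).trans (ex_elim' ?_)
    refine (and_intro (refl _) ((to_nabla_eq (fun p : (X ⊕ Y) × Y => p.2) (fun p => p.2)
      fun _ _ => rfl).trans (G.total.reindex fun p : (X ⊕ Y) × Y => p.2))).trans (ex_elim ?_)
    refine ex_intro (fun p : ((X ⊕ Y) × Y) × Z.carrier => p.2) (copairRel_inr (fun p => p.1.2)
      (fun p h => ?_) (and_right _ _))
    simp only [Sig.and_act_nonempty, Sig.nab_act_nonempty] at h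
    exact h.1

/-- The map `∇ (X ⊕ Y) ⟶ Z` with components `F` and `G`. -/
def FunRel.copair (F : FunRel ((nabla P).obj X) Z) (G : FunRel ((nabla P).obj Y) Z) :
    FunRel ((nabla P).obj (X ⊕ Y)) Z where
  rel := F.copairRel G
  strict := and_intro (to_nab fun _ _ => rfl) (copairRel_strict F G)
  congr := copairRel_congr F G
  single := copairRel_single F G
  total := copairRel_total F G

theorem FunRel.inl_copair (F : FunRel ((nabla P).obj X) Z) (G : FunRel ((nabla P).obj Y) Z) :
    (nabla P).map (↾(Sum.inl : X → X ⊕ Y)) ≫ (F.copair G).hom = F.hom := by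
  refine (FunRel.hom_eq (G := (HAsm.Hom.funRel ((nablaAsm P).map _)).comp (F.copair G)) ?_).symm
  exact ex_intro (fun p : X × Z.carrier => Sum.inl p.1) (and_intro
    (and_intro (to_nab fun _ _ => rfl) (to_nab fun _ _ => rfl))
    (copairRel_inl (fun p => p.1) (fun _ _ => rfl) (refl _)))

theorem FunRel.inr_copair (F : FunRel ((nabla P).obj X) Z) (G : FunRel ((nabla P).obj Y) Z) :
    (nabla P).map (↾(Sum.inr : Y → X ⊕ Y)) ≫ (F.copair G).hom = G.hom := by
  refine (FunRel.hom_eq (G := (HAsm.Hom.funRel ((nablaAsm P).map _)).comp (F.copair G)) ?_).symm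
  exact ex_intro (fun p : Y × Z.carrier => Sum.inr p.1) (and_intro
    (and_intro (to_nab fun _ _ => rfl) (to_nab fun _ _ => rfl))
    (copairRel_inr (fun p => p.1) (fun _ _ => rfl) (refl _)))

end Copair

/-- An entailment over an empty index set holds for trivial reasons. -/
theorem Entails.of_isEmpty {I : Type w} [IsEmpty I] (φ ψ : I → Sig P) : Entails φ ψ :=
  of_not_act fun i => isEmptyElim i

theorem nabla_isInitial : Nonempty (IsInitial ((nabla P).obj PEmpty)) := by
  have : IsEmpty ((nabla P).obj PEmpty).carrier := inferInstanceAs (IsEmpty PEmpty)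
  refine ⟨IsInitial.ofUniqueHom (fun Z => FunRel.hom
    { rel := fun x _ => isEmptyElim x
      strict := of_isEmpty _ _
      congr := ⟨idc, fun p => isEmptyElim p.1.1⟩
      single := of_isEmpty _ _
      total := of_isEmpty _ _ }) fun Z f => ?_⟩
  obtain ⟨F, rfl⟩ := HT.exists_hom_eq f
  exact FunRel.hom_eq (of_isEmpty _ _)

theorem nabla_isColimit_sum (X Y : Type u) : Nonempty (IsColimit (BinaryCofan.mk
    ((nabla P).map (↾(Sum.inl : X → X ⊕ Y))) ((nabla P).map (↾(Sum.inr : Y → X ⊕ Y))))) := by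
  have h : ∀ {Z : HT P} (f : (nabla P).obj X ⟶ Z) (g : (nabla P).obj Y ⟶ Z),
      ∃ k : (nabla P).obj (X ⊕ Y) ⟶ Z, (nabla P).map (↾Sum.inl) ≫ k = f ∧
        (nabla P).map (↾Sum.inr) ≫ k = g := by
    intro Z f g
    obtain ⟨F, rfl⟩ := HT.exists_hom_eq f
    obtain ⟨G, rfl⟩ := HT.exists_hom_eq g
    exact ⟨_, F.inl_copair G, F.inr_copair G⟩
  exact ⟨BinaryCofan.IsColimit.mk _ (fun f g => (h f g).choose) (fun f g => (h f g).choose_spec.1)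
    (fun f g => (h f g).choose_spec.2) fun f g m h1 h2 => nabla_sum_hom_ext
      (h1.trans (h f g).choose_spec.1.symm) (h2.trans (h f g).choose_spec.2.symm)⟩

instance nabla_preservesFiniteCoproducts : PreservesFiniteCoproducts (nabla P) := by
  have : PreservesColimitsOfShape (Discrete WalkingPair) (nabla P) := by
    refine ⟨fun {K} => ?_⟩
    have : PreservesColimit (Limits.pair (K.obj ⟨.left⟩) (K.obj ⟨.right⟩)) (nabla P) :=
      preservesColimit_of_preserves_colimit_cocone (Types.binaryCoproductColimit _ _)
        ((isColimitMapCoconeBinaryCofanEquiv (nabla P) _ _).symm (nabla_isColimit_sum _ _).some)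
    exact preservesColimit_of_iso_diagram _ (diagramIsoPair K).symm
  have : PreservesColimitsOfShape (Discrete.{0} PEmpty) (nabla P) := by
    have : PreservesColimit (Functor.empty.{0} (Type u)) (nabla P) :=
      preservesColimit_of_preserves_colimit_cocone (t := asEmptyCocone PEmpty)
        Types.isInitialPEmpty
        ((isColimitMapCoconeEmptyCoconeEquiv (nabla P) _).symm nabla_isInitial.some)
    exact preservesColimitsOfShape_pempty_of_preservesInitial _
  exact ⟨fun n => PreservesFiniteCoproducts.of_preserves_binary_and_initial _ _⟩

end Coproducts

/-! ### Fully faithful right adjoints and dependent products -/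

section Reflective

variable {C : Type u₁} [Category.{v₁} C] {D : Type u₂} [Category.{v₂} D] {G : D ⥤ C} {F : C ⥤ D}

theorem jointlyMono₂_map (adj : G ⊣ F) {R X : C} {a b : R ⟶ X} (h : JointlyMono₂ a b) :
    JointlyMono₂ (F.map a) (F.map b) where
  right_cancellation Y f g h1 h2 := by
    refine (adj.homEquiv _ _).symm.injective (h.right_cancellation _ _ ?_ ?_)
    · rw [← adj.homEquiv_naturality_right_symm, h1, adj.homEquiv_naturality_right_symm]
    · rw [← adj.homEquiv_naturality_right_symm, h2, adj.homEquiv_naturality_right_symm]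

theorem isEquivalenceRelation_map (adj : G ⊣ F) {R X : C} {a b : R ⟶ X}
    (h : IsEquivalenceRelation a b) : IsEquivalenceRelation (F.map a) (F.map b) := by
  obtain ⟨⟨e⟩⟩ := h
  have := jointlyMono₂_map adj e.toJointlyMono₂
  have := adj.rightAdjoint_preservesLimits
  exact ⟨⟨{ e.toReflexiveRelation.map F, e.toSymmetricRelation.map F,
    e.toTransitiveRelation.map F with }⟩⟩

theorem isEquivalenceRelation_of_map [F.Full] [F.Faithful] [HasPullbacks C] {R X : C} {a b : R ⟶ X}
    (h : IsEquivalenceRelation (F.map a) (F.map b)) : IsEquivalenceRelation a b := by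
  obtain ⟨⟨e⟩⟩ := h
  obtain ⟨l, hl1, hl2⟩ : ∃ l : F.obj (pullback b a) ⟶ e.c.pt,
      l ≫ e.c.fst = F.map (pullback.fst b a) ∧ l ≫ e.c.snd = F.map (pullback.snd b a) :=
    ⟨_, e.isLimit.fac (PullbackCone.mk (F.map (pullback.fst b a)) (F.map (pullback.snd b a))
      (by rw [← F.map_comp, pullback.condition, F.map_comp])) WalkingCospan.left,
      e.isLimit.fac _ WalkingCospan.right⟩
  refine ⟨⟨{
    right_cancellation := fun Y f g h1 h2 => F.map_injective (e.right_cancellation _ _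
      (by rw [← F.map_comp, h1, F.map_comp]) (by rw [← F.map_comp, h2, F.map_comp]))
    r := F.preimage e.r
    reflexivity₁ := F.map_injective (by simp)
    reflexivity₂ := F.map_injective (by simp)
    s := F.preimage e.s
    symmetry₁ := F.map_injective (by simp [e.symmetry₁])
    symmetry₂ := F.map_injective (by simp [e.symmetry₂])
    c := pullback.cone b a
    isLimit := pullback.isLimit b a
    t := F.preimage (l ≫ e.t)
    transitivity₁ := F.map_injective ?_
    transitivity₂ := F.map_injective ?_ }⟩⟩
  · rw [F.map_comp, F.map_preimage, Category.assoc, e.transitivity₁, ← Category.assoc, hl1,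
      ← F.map_comp]
    rfl
  · rw [F.map_comp, F.map_preimage, Category.assoc, e.transitivity₂, ← Category.assoc, hl2,
      ← F.map_comp]
    rfl

/-- A fully faithful right adjoint whose left adjoint preserves pullbacks preserves dependent
products: a test diagram in `D` transposes to one in `C`. -/
theorem IsDependentProduct.map (adj : G ⊣ F) [F.Full] [F.Faithful]
    [PreservesLimitsOfShape WalkingCospan G] {S B A T W : C} {g : S ⟶ B} {f : B ⟶ A} {p : T ⟶ A}
    {fst : W ⟶ T} {snd : W ⟶ B} {ev : W ⟶ S} (H : IsDependentProduct g f p fst snd ev) :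
    IsDependentProduct (F.map g) (F.map f) (F.map p) (F.map fst) (F.map snd) (F.map ev) where
  isPullback := by
    have := adj.rightAdjoint_preservesLimits
    exact H.isPullback.map F
  ev_comp := by rw [← F.map_comp, H.ev_comp]
  existsUnique Z V h q r e hp he := by
    -- The transpose of the pullback square is `G` of it, followed by counits, which are invertible.
    have hp' : IsPullback (G.map q) ((adj.homEquiv _ _).symm r) ((adj.homEquiv _ _).symm h) f := by
      rw [adj.homEquiv_counit, adj.homEquiv_counit]
      exact (hp.map G).paste_vert
        (IsPullback.of_vert_isIso ⟨(adj.counit.naturality f)⟩)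
    have he' : (adj.homEquiv _ _).symm e ≫ g = (adj.homEquiv _ _).symm r := by
      rw [← adj.homEquiv_naturality_right_symm, he]
    refine ((adj.homEquiv Z T).symm.existsUnique_congr fun t => ?_).2
      (H.existsUnique _ _ _ _ hp' he')
    rw [← adj.homEquiv_naturality_right_symm, EmbeddingLike.apply_eq_iff_eq]
    refine and_congr_right fun _ => (adj.homEquiv V W).symm.forall_congr fun w => ?_
    rw [← adj.homEquiv_naturality_left_symm, ← adj.homEquiv_naturality_right_symm,
      ← adj.homEquiv_naturality_right_symm, ← adj.homEquiv_naturality_right_symm]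
    simp only [EmbeddingLike.apply_eq_iff_eq]

theorem IsDependentProduct.of_map [F.Full] [F.Faithful] [PreservesLimitsOfShape WalkingCospan F]
    {S B A T W : C} {g : S ⟶ B} {f : B ⟶ A} {p : T ⟶ A} {fst : W ⟶ T} {snd : W ⟶ B} {ev : W ⟶ S}
    (H : IsDependentProduct (F.map g) (F.map f) (F.map p) (F.map fst) (F.map snd) (F.map ev)) :
    IsDependentProduct g f p fst snd ev where
  isPullback := IsPullback.of_map_of_faithful F H.isPullback
  ev_comp := F.map_injective (by rw [F.map_comp, H.ev_comp])
  existsUnique Z V h q r e hp he := by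
    have hF : F.FullyFaithful := Functor.FullyFaithful.ofFullyFaithful F
    refine (hF.homEquiv.existsUnique_congr fun t => ?_).2
      (H.existsUnique (F.map h) _ _ (F.map e) (hp.map F) (by rw [← F.map_comp, he]))
    refine and_congr ?_ (hF.homEquiv.forall_congr fun w => ?_)
    · simp only [Functor.FullyFaithful.homEquiv_apply, ← F.map_comp, F.map_injective.eq_iff]
    · simp only [Functor.FullyFaithful.homEquiv_apply, ← F.map_comp, F.map_injective.eq_iff]

end Reflective

/-! ### Regular epimorphisms and quotients of sets -/

section Sets

variable {D : Type u₂} [Category.{v₂} D] (F : Type u ⥤ D)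

/-- By the axiom of choice every surjection of sets splits. -/
theorem isSplitEpi_of_surjective {X Y : Type u} (f : X ⟶ Y) (hf : Function.Surjective f) :
    IsSplitEpi f :=
  ⟨⟨⟨↾(Function.surjInv hf), by
    ext y
    exact Function.surjInv_eq hf y⟩⟩⟩

theorem isRegularEpi_map {X Y : Type u} {f : X ⟶ Y} (hf : IsRegularEpi f) :
    IsRegularEpi (F.map f) := by
  have := isSplitEpi_of_surjective f ((epi_iff_surjective f).1 inferInstance)
  infer_instance

theorem isRegularEpi_of_map [F.Faithful] {X Y : Type u} {f : X ⟶ Y}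
    (hf : IsRegularEpi (F.map f)) : IsRegularEpi f := by
  have : Epi f := F.epi_of_epi_map inferInstance
  have := isSplitEpi_of_surjective f ((epi_iff_surjective f).1 inferInstance)
  infer_instance

/-- The quotient of an equivalence relation in sets is a split coequalizer: choose representatives
`s` and send `x` to the witness that the representative of its class is related to `x`. -/
theorem IsQuotient.isSplitCoequalizer {R X Q : Type u} {a b : R ⟶ X} {q : X ⟶ Q}
    (h : IsQuotient a b q) : Nonempty (IsSplitCoequalizer a b q) := by
  obtain ⟨⟨e⟩⟩ := h.isEquivalenceRelation
  obtain ⟨hq⟩ := h.isColimit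
  -- Comparing `q` with the quotient of sets shows that `q` identifies only related elements.
  let st : Setoid X := ⟨_, TypeCat.equivalence_of_equivalenceRelation e⟩
  have hsurj : Function.Surjective q := (epi_iff_surjective q).1 (epi_of_isColimit_cofork hq)
  obtain ⟨m, hm⟩ := Cofork.IsColimit.desc' hq (↾(Quotient.mk st)) (by
    ext r
    exact Quotient.sound ⟨r, rfl, rfl⟩)
  have hrel : ∀ x, ∃ r, a r = Function.surjInv hsurj (q x) ∧ b r = x := fun x => by
    refine Quotient.exact (s := st) ?_
    have h1 := ConcreteCategory.congr_hom hm
    refine (h1 _).symm.trans (Eq.trans ?_ (h1 x))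
    exact congrArg m (Function.surjInv_eq hsurj (q x))
  choose t ht1 ht2 using hrel
  exact ⟨{
    rightSection := ↾(Function.surjInv hsurj)
    leftSection := ↾t
    condition := h.w
    rightSection_π := by ext y; exact Function.surjInv_eq hsurj y
    leftSection_bottom := by ext x; exact ht2 x
    leftSection_top := by ext x; exact ht1 x }⟩

theorem IsQuotient.map {G : D ⥤ Type u} (adj : G ⊣ F) {R X Q : Type u} {a b : R ⟶ X} {q : X ⟶ Q}
    (h : IsQuotient a b q) : IsQuotient (F.map a) (F.map b) (F.map q) where
  isEquivalenceRelation := isEquivalenceRelation_map adj h.isEquivalenceRelation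
  w := by rw [← F.map_comp, h.w, F.map_comp]
  isColimit := ⟨(h.isSplitCoequalizer.some.map F).isCoequalizer⟩

theorem IsQuotient.of_map [F.Full] [F.Faithful] {R X Q : Type u} {a b : R ⟶ X} {q : X ⟶ Q}
    (h : IsQuotient (F.map a) (F.map b) (F.map q)) : IsQuotient a b q where
  isEquivalenceRelation := isEquivalenceRelation_of_map h.isEquivalenceRelation
  w := F.map_injective (by rw [F.map_comp, h.w, F.map_comp])
  isColimit := ⟨isColimitOfIsColimitCoforkMap F _ h.isColimit.some⟩

end Sets

/-! ### Point-determined functors -/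

namespace PointDetermined

section

variable {D : Type u₂} [Category.{v₂} D] {F : Type u ⥤ D}

theorem const_comp {Y Y' : Type u} (y : Y) (f : Y ⟶ Y') :
    F.map (↾fun _ : PUnit.{u + 1} => y) ≫ F.map f = F.map (↾fun _ : PUnit.{u + 1} => f y) := by
  rw [← F.map_comp]
  rfl

variable (hF : PointDetermined F)
include hF

theorem const_injective {Y : Type u} {y y' : Y}
    (h : F.map (↾fun _ : PUnit.{u + 1} => y) = F.map (↾fun _ : PUnit.{u + 1} => y')) : y = y' :=
  (hF.existsUnique_point _).unique h rfl

/-- The element of `Y` corresponding to a point of `F Y`. -/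
def elt {Y : Type u} (p : F.obj PUnit ⟶ F.obj Y) : Y := (hF.existsUnique_point p).choose

theorem const_elt {Y : Type u} (p : F.obj PUnit ⟶ F.obj Y) :
    F.map (↾fun _ : PUnit.{u + 1} => hF.elt p) = p :=
  (hF.existsUnique_point p).choose_spec.1

theorem elt_eq {Y : Type u} {p : F.obj PUnit ⟶ F.obj Y} {y : Y}
    (h : F.map (↾fun _ : PUnit.{u + 1} => y) = p) : hF.elt p = y :=
  hF.const_injective ((hF.const_elt p).trans h.symm)

theorem elt_comp {Y Y' : Type u} (p : F.obj PUnit ⟶ F.obj Y) (f : Y ⟶ Y') :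
    hF.elt (p ≫ F.map f) = f (hF.elt p) :=
  hF.elt_eq (by rw [← const_comp, hF.const_elt])

theorem faithful : F.Faithful where
  map_injective {X Y f g} h := by
    ext x
    refine hF.const_injective ?_
    rw [← const_comp, h, const_comp]

theorem full : F.Full where
  map_surjective {X Y} f := ⟨↾fun x => hF.elt (F.map (↾fun _ : PUnit.{u + 1} => x) ≫ f),
    hF.hom_ext fun p => by
      obtain ⟨x, rfl, -⟩ := hF.existsUnique_point p
      rw [const_comp]
      exact hF.const_elt _⟩

end

section

variable {D : Type u₂} [Category.{u} D] {F : Type u ⥤ D} (hF : PointDetermined F)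
include hF

/-- Maps `Z ⟶ F Y` correspond to functions on the points of `Z`. -/
def pointsEquiv (Z : D) (Y : Type u) :
    (Z ⟶ F.obj Y) ≃ ((coyoneda.obj (Opposite.op (F.obj PUnit.{u + 1}))).obj Z ⟶ Y) :=
  Equiv.ofBijective (fun f => ↾fun p => hF.elt (p ≫ f))
    ⟨fun f g h => hF.hom_ext fun p => by
      rw [← hF.const_elt (p ≫ f), ← hF.const_elt (p ≫ g)]
      exact congrArg (fun y => F.map (↾fun _ : PUnit.{u + 1} => y))
        (ConcreteCategory.congr_hom h p),
    fun g => by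
      obtain ⟨f, hf⟩ := hF.exists_hom g
      refine ⟨f, ?_⟩
      ext p
      exact hF.elt_eq (hf p).symm⟩

theorem pointsEquiv_comp {Z : D} {Y Y' : Type u} (f : Z ⟶ F.obj Y) (g : Y ⟶ Y') :
    hF.pointsEquiv Z Y' (f ≫ F.map g) = hF.pointsEquiv Z Y f ≫ g := by
  ext p
  exact (congrArg hF.elt (Category.assoc _ _ _).symm).trans (hF.elt_comp _ g)

/-- The functor `Hom(F 1, -)` of points is left adjoint to `F`. -/
def adjunction : coyoneda.obj (Opposite.op (F.obj PUnit.{u + 1})) ⊣ F :=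
  Adjunction.mkOfHomEquiv
    { homEquiv := fun Z Y => (hF.pointsEquiv Z Y).symm
      homEquiv_naturality_left_symm := fun f g => by
        ext p
        exact congrArg hF.elt (Category.assoc _ _ _).symm
      homEquiv_naturality_right := fun f g => by
        rw [Equiv.symm_apply_eq, pointsEquiv_comp, Equiv.apply_symm_apply] }

theorem preservesFiniteLimits : PreservesFiniteLimits F :=
  have := hF.adjunction.rightAdjoint_preservesLimits
  inferInstance

theorem preservesLCCPretopos [PreservesFiniteCoproducts F] : PreservesLCCPretopos F where
  finiteLimits := hF.preservesFiniteLimits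
  finiteSums := inferInstance
  covers _ _ _ := isRegularEpi_map F
  equivalenceRelations _ _ _ _ := isEquivalenceRelation_map hF.adjunction
  quotients _ _ _ _ _ _ h := h.map F hF.adjunction
  dependentProducts _ _ _ _ _ _ _ _ _ _ _ h :=
    have := hF.full
    have := hF.faithful
    h.map hF.adjunction

theorem reflectsLCCPretopos : ReflectsLCCPretopos F :=
  have := hF.full
  have := hF.faithful
  have := hF.preservesFiniteLimits
  { finiteLimits := inferInstance
    finiteSums := ⟨fun _ => inferInstance⟩
    covers := fun _ _ _ => isRegularEpi_of_map F
    equivalenceRelations := fun _ _ _ _ => isEquivalenceRelation_of_map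
    quotients := fun _ _ _ _ _ _ h => h.of_map
    dependentProducts := fun _ _ _ _ _ _ _ _ _ _ _ h => h.of_map }

end

end PointDetermined

/-! ### Interpretations of formulas -/

namespace CatStructure

variable {S : Signature.{w}} {C : Type u₁} [Category.{v₁} C]

theorem Interprets.unique (N : CatStructure S C) {Γ : List S.Srt} {φ : Formula S Γ} :
    ∀ {A A' : Subobject (N.ctx Γ)}, N.Interprets φ A → N.Interprets φ A' → A = A' := by
  have hfac : ∀ {Γ : List S.Srt} {A A' : Subobject (N.ctx Γ)},
      (∀ ⦃Z : C⦄ (z : Z ⟶ N.ctx Γ), A.Factors z ↔ A'.Factors z) → A = A' := fun h =>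
    le_antisymm (Subobject.le_of_factors ((h _).1 (Subobject.factors_self _)))
      (Subobject.le_of_factors ((h _).2 (Subobject.factors_self _)))
  induction φ with
  | bot => exact fun h h' => le_antisymm (h _) (h' _)
  | top => exact fun h h' => le_antisymm (h' _) (h _)
  | eq t t' => exact fun h h' => hfac fun Z z => (h z).trans (h' z).symm
  | rel R ts => exact fun h h' => hfac fun Z z => (h z).trans (h' z).symm
  | and φ ψ ihφ ihψ =>
    rintro A A' ⟨B, B', h1, h2, h⟩ ⟨E, E', h1', h2', h'⟩
    obtain rfl := ihφ h1 h1'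
    obtain rfl := ihψ h2 h2'
    exact h.unique h'
  | or φ ψ ihφ ihψ =>
    rintro A A' ⟨B, B', h1, h2, h⟩ ⟨E, E', h1', h2', h'⟩
    obtain rfl := ihφ h1 h1'
    obtain rfl := ihψ h2 h2'
    exact h.unique h'
  | imp φ ψ ihφ ihψ =>
    rintro A A' ⟨B, B', h1, h2, h⟩ ⟨E, E', h1', h2', h'⟩
    obtain rfl := ihφ h1 h1'
    obtain rfl := ihψ h2 h2'
    exact eq_of_forall_le_iff fun X => (h X).trans (h' X).symm
  | ex s φ ih =>
    rintro A A' ⟨B, h1, h⟩ ⟨E, h1', h'⟩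
    obtain rfl := ih h1 h1'
    exact eq_of_forall_ge_iff fun X => (h X).trans (h' X).symm
  | all s φ ih =>
    rintro A A' ⟨B, h1, h⟩ ⟨E, h1', h'⟩
    obtain rfl := ih h1 h1'
    exact eq_of_forall_le_iff fun X => (h X).trans (h' X).symm

end CatStructure

section Subobjects

instance mono_subtype_val {X : Type u} (A : Set X) : Mono (↾(Subtype.val : A → X)) :=
  (ofHom_mono_iff_injective _).2 Subtype.val_injective

variable {D : Type u₂} [Category.{u} D] (F : Type u ⥤ D) [PreservesFiniteLimits F]

/-- The subobject of `F X` given by a subset of `X`. -/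
def mapSubset {X : Type u} (A : Set X) : Subobject (F.obj X) :=
  Subobject.mk (F.map (↾(Subtype.val : A → X)))

variable {F}

theorem mapSubset_le_iff {X : Type u} {A : Set X} {B : Subobject (F.obj X)} :
    mapSubset F A ≤ B ↔ B.Factors (F.map (↾(Subtype.val : A → X))) :=
  ⟨fun h => Subobject.factors_of_le _ h (Subobject.mk_factors_self _),
    fun h => Subobject.mk_le_of_comm _ (B.factorThru_arrow _ h)⟩

theorem mk_map_arrow {X : Type u} (A : Set X) :
    Subobject.mk (F.map (Subobject.mk (↾(Subtype.val : A → X))).arrow) = mapSubset F A :=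
  Subobject.mk_eq_mk_of_comm _ _ (F.mapIso (Subobject.underlyingIso (↾(Subtype.val : A → X)))) (by
    rw [Functor.mapIso_hom, ← F.map_comp, Subobject.underlyingIso_hom_comp_eq_mk])

theorem factors_arrow_comp_iff {X Y : Type u} {A : Set X} {k : F.obj X ⟶ F.obj Y}
    {B : Subobject (F.obj Y)} : B.Factors ((mapSubset F A).arrow ≫ k) ↔
      B.Factors (F.map (↾(Subtype.val : A → X)) ≫ k) := by
  constructor <;> intro h
  · rw [← Subobject.underlyingIso_arrow (F.map (↾(Subtype.val : A → X))), Category.assoc]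
    exact Subobject.factors_of_factors_right _ h
  · rw [mapSubset, ← Subobject.underlyingIso_hom_comp_eq_mk, Category.assoc]
    exact Subobject.factors_of_factors_right _ h

/-- Images: a surjection of sets splits, so `F` carries the image of a subset to the image. -/
theorem mapSubset_image_le_iff {X Y : Type u} {A : Set X} (d : X ⟶ Y) {B : Subobject (F.obj Y)} :
    mapSubset F (d '' A) ≤ B ↔ B.Factors (F.map (↾(Subtype.val : A → X)) ≫ F.map d) := by
  rw [mapSubset_le_iff, ← F.map_comp]
  constructor <;> intro h
  · have e : ↾(Subtype.val : A → X) ≫ d =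
      (↾fun a : A => (⟨d a, a, a.2, rfl⟩ : d '' A)) ≫ ↾Subtype.val := rfl
    rw [e, F.map_comp]
    exact Subobject.factors_of_factors_right _ h
  · choose s hs hs' using fun y : d '' A => y.2
    have e : ↾(Subtype.val : d '' A → Y) =
        (↾fun y => (⟨s y, hs y⟩ : A)) ≫ ↾(Subtype.val : A → X) ≫ d := by
      ext y
      exact (hs' y).symm
    rw [e, F.map_comp]
    exact Subobject.factors_of_factors_right _ h

section

variable [PreservesFiniteCoproducts F]

theorem sum_hom_ext {X Y : Type u} {Z : D} {f g : F.obj (X ⊕ Y) ⟶ Z}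
    (hl : F.map (↾(Sum.inl : X → X ⊕ Y)) ≫ f = F.map (↾Sum.inl) ≫ g)
    (hr : F.map (↾(Sum.inr : Y → X ⊕ Y)) ≫ f = F.map (↾Sum.inr) ≫ g) : f = g :=
  BinaryCofan.IsColimit.hom_ext
    (mapIsColimitOfPreservesOfIsColimit F _ _ (Types.binaryCoproductColimit X Y)) hl hr

theorem exists_desc_sum {X Y : Type u} {Z : D} (f : F.obj X ⟶ Z) (g : F.obj Y ⟶ Z) :
    ∃ d : F.obj (X ⊕ Y) ⟶ Z, F.map (↾Sum.inl) ≫ d = f ∧ F.map (↾Sum.inr) ≫ d = g :=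
  have hc := mapIsColimitOfPreservesOfIsColimit F _ _ (Types.binaryCoproductColimit X Y)
  ⟨_, hc.fac (BinaryCofan.mk f g) ⟨.left⟩, hc.fac (BinaryCofan.mk f g) ⟨.right⟩⟩

end

namespace PointDetermined

variable (hF : PointDetermined F)
include hF

theorem factors_mapSubset_iff {Z : D} {X : Type u} {A : Set X} {z : Z ⟶ F.obj X} :
    (mapSubset F A).Factors z ↔ ∀ p : F.obj PUnit ⟶ Z, hF.elt (p ≫ z) ∈ A := by
  constructor
  · rintro ⟨(k : Z ⟶ F.obj A), hk⟩ p
    replace hk : k ≫ F.map (↾(Subtype.val : A → X)) = z := hk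
    rw [← hk, ← Category.assoc, hF.elt_comp]
    exact (hF.elt (p ≫ k)).2
  · intro h
    obtain ⟨f, hf⟩ := hF.exists_hom fun p => (⟨_, h p⟩ : A)
    have hz : f ≫ F.map (↾(Subtype.val : A → X)) = z := hF.hom_ext fun p => by
      rw [← Category.assoc, hf, const_comp]
      exact hF.const_elt _
    exact ⟨f, hz⟩

/-- The equalizer of two maps between images of sets. -/
theorem factors_mapSubset_iff_comp_eq {Z : D} {X Y : Type u} {z : Z ⟶ F.obj X} {A : Set X}
    {f g : X ⟶ Y} (hA : ∀ x, x ∈ A ↔ f x = g x) :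
    (mapSubset F A).Factors z ↔ z ≫ F.map f = z ≫ F.map g := by
  simp only [hF.factors_mapSubset_iff, hA, ← hF.elt_comp]
  constructor
  · intro h
    refine hF.hom_ext fun p => ?_
    rw [← Category.assoc, ← Category.assoc, ← hF.const_elt ((p ≫ z) ≫ F.map f), h, hF.const_elt]
  · intro h p
    rw [Category.assoc, h, Category.assoc]

/-- Pullbacks of subobjects given by subsets. -/
theorem factors_mapSubset_iff_comp {Z : D} {X Y : Type u} {z : Z ⟶ F.obj X} {A : Set X} {B : Set Y}
    {f : X ⟶ Y} (hA : ∀ x, x ∈ A ↔ f x ∈ B) :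
    (mapSubset F A).Factors z ↔ (mapSubset F B).Factors (z ≫ F.map f) := by
  simp only [hF.factors_mapSubset_iff, hA, ← hF.elt_comp, Category.assoc]

theorem factors_mapSubset_const {X : Type u} {A : Set X} {x : X} :
    (mapSubset F A).Factors (F.map (↾fun _ : PUnit.{u + 1} => x)) ↔ x ∈ A := by
  rw [hF.factors_mapSubset_iff]
  have h : ∀ p : F.obj PUnit.{u + 1} ⟶ F.obj PUnit,
      hF.elt (p ≫ F.map (↾fun _ : PUnit.{u + 1} => x)) = x := fun p => hF.elt_comp p _
  simp only [h]
  exact ⟨fun h => h (𝟙 _), fun h _ => h⟩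

/-- A subobject of `F X` lies in the subobject given by a subset as soon as its points do. -/
theorem le_mapSubset_iff {X : Type u} {A : Set X} {B : Subobject (F.obj X)} :
    B ≤ mapSubset F A ↔ ∀ x, B.Factors (F.map (↾fun _ : PUnit.{u + 1} => x)) → x ∈ A := by
  constructor
  · exact fun h x hx => hF.factors_mapSubset_const.1 (Subobject.factors_of_le _ h hx)
  · refine fun h => Subobject.le_of_factors (hF.factors_mapSubset_iff.2 fun p => h _ ?_)
    rw [hF.const_elt]
    exact Subobject.factors_of_factors_right _ (Subobject.factors_self B)

theorem mapSubset_mono {X : Type u} {A B : Set X} (h : A ⊆ B) : mapSubset F A ≤ mapSubset F B :=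
  hF.le_mapSubset_iff.2 fun _ hx => h (hF.factors_mapSubset_const.1 hx)

theorem mapSubset_singleton_le_iff {X : Type u} {x : X} {B : Subobject (F.obj X)} :
    mapSubset F {x} ≤ B ↔ B.Factors (F.map (↾fun _ : PUnit.{u + 1} => x)) := by
  constructor
  · exact fun h => Subobject.factors_of_le _ h (hF.factors_mapSubset_const.2 rfl)
  · intro h
    have e : ↾(Subtype.val : ({x} : Set X) → X) =
        (↾fun _ => PUnit.unit) ≫ ↾fun _ : PUnit.{u + 1} => x := by
      ext y
      exact y.2
    rw [mapSubset_le_iff, e, F.map_comp]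
    exact Subobject.factors_of_factors_right _ h

theorem isGLB_mapSubset {X : Type u} (A B : Set X) :
    IsGLB {mapSubset F A, mapSubset F B} (mapSubset F (A ∩ B)) := by
  constructor
  · rintro _ (rfl | rfl)
    · exact hF.mapSubset_mono Set.inter_subset_left
    · exact hF.mapSubset_mono Set.inter_subset_right
  · exact fun E hE => hF.le_mapSubset_iff.2 fun x hx =>
      ⟨hF.le_mapSubset_iff.1 (hE (Or.inl rfl)) x hx, hF.le_mapSubset_iff.1 (hE (Or.inr rfl)) x hx⟩

/-- Implication is tested on points, and a point is itself a subobject. -/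
theorem le_mapSubset_imp_iff {X : Type u} {A B : Set X} {E : Subobject (F.obj X)} :
    E ≤ mapSubset F {x | x ∈ A → x ∈ B} ↔
      ∀ Y, Y ≤ E → Y ≤ mapSubset F A → Y ≤ mapSubset F B := by
  constructor
  · exact fun h Y hY hA => hF.le_mapSubset_iff.2 fun x hx => hF.le_mapSubset_iff.1 (hY.trans h) x hx
      (hF.le_mapSubset_iff.1 hA x hx)
  · refine fun h => hF.le_mapSubset_iff.2 fun x hx hA => ?_
    exact hF.factors_mapSubset_const.1 (hF.mapSubset_singleton_le_iff.1 (h _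
      (hF.mapSubset_singleton_le_iff.2 hx)
      (hF.mapSubset_singleton_le_iff.2 (hF.factors_mapSubset_const.2 hA))))

theorem le_mapSubset_forall_iff {X Y : Type u} {A : Set X} {d : X ⟶ Y} {E : Subobject (F.obj Y)} :
    E ≤ mapSubset F {y | ∀ x, d x = y → x ∈ A} ↔
      ∀ B : Subobject (F.obj X), E.Factors (B.arrow ≫ F.map d) → B ≤ mapSubset F A := by
  constructor
  · intro h B hB
    refine hF.le_mapSubset_iff.2 fun x hx => hF.le_mapSubset_iff.1 h (d x) ?_ x rfl
    rw [← const_comp, ← B.factorThru_arrow _ hx, Category.assoc]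
    exact Subobject.factors_of_factors_right _ hB
  · rintro h
    refine hF.le_mapSubset_iff.2 ?_
    rintro _ hy x rfl
    refine hF.factors_mapSubset_const.1 (hF.mapSubset_singleton_le_iff.1 (h _ ?_))
    rw [factors_arrow_comp_iff, ← mapSubset_image_le_iff, Set.image_singleton]
    exact hF.mapSubset_singleton_le_iff.2 hy

variable [PreservesFiniteCoproducts F]

theorem isBot_mapSubset_empty {X : Type u} : IsBot (mapSubset F (∅ : Set X)) := by
  intro B
  have hi : IsInitial (F.obj (∅ : Set X)) := IsInitial.isInitialObj F _
    ((Types.initial_iff_empty _).2 inferInstance).some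
  have e : F.map (↾(Subtype.val : (∅ : Set X) → X)) = hi.to (B : D) ≫ B.arrow := hi.hom_ext _ _
  rw [mapSubset_le_iff, e]
  exact Subobject.factors_comp_arrow _

/-- A union is the image of a disjoint union, which `F` preserves. -/
theorem isLUB_mapSubset {X : Type u} (A B : Set X) :
    IsLUB {mapSubset F A, mapSubset F B} (mapSubset F (A ∪ B)) := by
  classical
  constructor
  · rintro _ (rfl | rfl)
    · exact hF.mapSubset_mono Set.subset_union_left
    · exact hF.mapSubset_mono Set.subset_union_right
  · intro E hE
    have hA := mapSubset_le_iff.1 (hE (Or.inl rfl))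
    have hB := mapSubset_le_iff.1 (hE (Or.inr rfl))
    let k : A ⊕ B → X := Sum.elim Subtype.val Subtype.val
    obtain ⟨d, hl, hr⟩ := exists_desc_sum (F := F) (E.factorThru _ hA) (E.factorThru _ hB)
    have hk : F.map (↾k) = d ≫ E.arrow := by
      refine sum_hom_ext ?_ ?_
      · rw [← Category.assoc, hl, E.factorThru_arrow, ← F.map_comp]
        rfl
      · rw [← Category.assoc, hr, E.factorThru_arrow, ← F.map_comp]
        rfl
    have e : ↾(Subtype.val : ↥(A ∪ B) → X) = (↾fun x => if h : x.1 ∈ A then Sum.inl ⟨x.1, h⟩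
        else Sum.inr ⟨x.1, x.2.resolve_left h⟩) ≫ ↾k := by
      ext x
      by_cases h : x.1 ∈ A <;> simp [h, k]
    rw [mapSubset_le_iff, e, F.map_comp, hk]
    exact Subobject.factors_of_factors_right _ (Subobject.factors_comp_arrow _)

end PointDetermined

end Subobjects

/-! ### Validity of first-order formulas -/

namespace SetStructure

variable {S : Signature.{w}} (M : SetStructure.{w, u} S) {D : Type u₂} [Category.{u} D]
  {F : Type u ⥤ D} [PreservesFiniteLimits F]

theorem tuple_map {Γ Δ : List S.Srt}
    (f : ∀ i : Fin Δ.length, M.Assignment Γ → M.carrier (Δ.get i)) :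
    (M.toCat.map F).tuple (X := F.obj (M.Assignment Γ)) (Γ := Δ) (fun i => F.map (↾(f i))) =
      F.map (↾fun v i => f i v : M.Assignment Γ ⟶ M.Assignment Δ) := by
  refine Fan.IsLimit.hom_ext ((M.toCat.map F).isProduct Δ) _ _ fun i => ?_
  refine (((M.toCat.map F).isProduct Δ).fac _ ⟨i⟩).trans ?_
  exact F.map_comp (↾fun v i => f i v : M.Assignment Γ ⟶ M.Assignment Δ) (M.toCat.proj Δ i)

theorem value_map {Γ : List S.Srt} {s : S.Srt} (t : Term S Γ s) :
    (M.toCat.map F).value t = F.map (↾fun v : M.Assignment Γ => M.value v t) := by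
  induction t with
  | var i => rfl
  | fn f ts ih =>
    have h := (congrArg (M.toCat.map F).tuple (funext ih)).trans
      (M.tuple_map fun i v => M.value v (ts i))
    exact (congrArg (· ≫ F.map (↾M.fn f)) h).trans
      (F.map_comp (↾fun v i => M.value v (ts i)) (↾M.fn f)).symm

theorem rel_map (R : S.Rel) : (M.toCat.map F).rel R = mapSubset F (M.rel R) :=
  mk_map_arrow (X := M.Assignment (S.ar R)) (M.rel R)

/-- The function forgetting the value of the first variable. -/
def dropFirst (s : S.Srt) (Γ : List S.Srt) : M.Assignment (s :: Γ) ⟶ M.Assignment Γ :=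
  ↾fun v i => v i.succ

theorem drop_map (s : S.Srt) (Γ : List S.Srt) :
    (M.toCat.map F).drop s Γ = F.map (M.dropFirst s Γ) :=
  M.tuple_map fun (i : Fin Γ.length) (v : M.Assignment (s :: Γ)) => v i.succ

theorem extend_dropFirst {s : S.Srt} {Γ : List S.Srt} (v : M.Assignment (s :: Γ)) :
    M.extend (s := s) (v (0 : Fin (Γ.length + 1))) (M.dropFirst s Γ v) = v :=
  Fin.cons_self_tail (α := fun i : Fin (Γ.length + 1) => M.carrier ((s :: Γ).get i)) v

theorem sat_ex_iff {s : S.Srt} {Γ : List S.Srt} {φ : Formula S (s :: Γ)} {v : M.Assignment Γ} :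
    M.Sat (.ex s φ) v ↔ ∃ v', M.Sat φ v' ∧ M.dropFirst s Γ v' = v := by
  constructor
  · rintro ⟨a, ha⟩
    exact ⟨_, ha, rfl⟩
  · rintro ⟨v', hv, rfl⟩
    exact ⟨_, (congrArg (M.Sat φ) (M.extend_dropFirst v')).mpr hv⟩

theorem sat_all_iff {s : S.Srt} {Γ : List S.Srt} {φ : Formula S (s :: Γ)} {v : M.Assignment Γ} :
    M.Sat (.all s φ) v ↔ ∀ v', M.dropFirst s Γ v' = v → M.Sat φ v' := by
  constructor
  · rintro h v' rfl
    exact (congrArg (M.Sat φ) (M.extend_dropFirst v')).mp (h _)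
  · exact fun h a => h _ rfl

variable (F) in
/-- The subobject of the context given by the assignments that satisfy `φ`. -/
def satSubobject {Γ : List S.Srt} (φ : Formula S Γ) : Subobject ((M.toCat.map F).ctx Γ) :=
  mapSubset F {v : M.Assignment Γ | M.Sat φ v}

variable (hF : PointDetermined F) [PreservesFiniteCoproducts F]
include hF

theorem interprets_satSubobject {Γ : List S.Srt} (φ : Formula S Γ) :
    (M.toCat.map F).Interprets φ (M.satSubobject F φ) := by
  induction φ with
  | bot => exact hF.isBot_mapSubset_empty
  | top => exact fun B => hF.le_mapSubset_iff.2 fun _ _ => trivial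
  | eq t t' =>
    intro Z z
    rw [value_map, value_map]
    exact hF.factors_mapSubset_iff_comp_eq fun _ => Iff.rfl
  | rel R ts =>
    intro Z z
    have h := (congrArg (M.toCat.map F).tuple (funext fun i => M.value_map (ts i))).trans
      (M.tuple_map fun i v => M.value v (ts i))
    rw [rel_map, h]
    exact hF.factors_mapSubset_iff_comp fun _ => Iff.rfl
  | and φ ψ ihφ ihψ => exact ⟨_, _, ihφ, ihψ, hF.isGLB_mapSubset _ _⟩
  | or φ ψ ihφ ihψ => exact ⟨_, _, ihφ, ihψ, hF.isLUB_mapSubset _ _⟩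
  | imp φ ψ ihφ ihψ => exact ⟨_, _, ihφ, ihψ, fun _ => hF.le_mapSubset_imp_iff⟩
  | @ex Γ s φ ih =>
    refine ⟨_, ih, fun X => ?_⟩
    have e : M.satSubobject F (.ex s φ) =
        mapSubset F (M.dropFirst s Γ '' {v : M.Assignment (s :: Γ) | M.Sat φ v}) :=
      congrArg (mapSubset F) (Set.ext fun v => M.sat_ex_iff)
    rw [e, drop_map]
    exact (mapSubset_image_le_iff _).trans factors_arrow_comp_iff.symm
  | @all Γ s φ ih =>
    refine ⟨_, ih, fun X => ?_⟩
    have e : M.satSubobject F (.all s φ) = mapSubset F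
        {v | ∀ v', M.dropFirst s Γ v' = v → v' ∈ {v : M.Assignment (s :: Γ) | M.Sat φ v}} :=
      congrArg (mapSubset F) (Set.ext fun v => M.sat_all_iff)
    rw [e, drop_map]
    exact hF.le_mapSubset_forall_iff

theorem valid_map_iff {Γ : List S.Srt} (φ : Formula S Γ) :
    M.Valid φ ↔ (M.toCat.map F).Valid φ := by
  have h := M.interprets_satSubobject hF φ
  constructor
  · intro hv
    have e : M.satSubobject F φ = ⊤ := top_le_iff.1 (hF.le_mapSubset_iff.2 fun v _ => hv v)
    rwa [e] at h
  · intro hv v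
    have e : M.satSubobject F φ = ⊤ := h.unique _ hv
    exact hF.le_mapSubset_iff.1 e.ge v (Subobject.top_factors _)

end SetStructure

end Herbrand

end

theorem mainTheorem5 {P : Type u} [Herbrand.PCA P] [Nontrivial P] :
    Herbrand.PreservesLCCPretopos (Herbrand.nabla P) ∧
    Herbrand.ReflectsLCCPretopos (Herbrand.nabla P) ∧
    (∃ _ : PreservesFiniteLimits (Herbrand.nabla P),
      ∀ (S : Herbrand.Signature.{w}) (M : Herbrand.SetStructure.{w, u} S) (Γ : List S.Srt)
        (φ : Herbrand.Formula S Γ),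
        M.Valid φ ↔ (M.toCat.map (Herbrand.nabla P)).Valid φ) ∧
    Nonempty (IsTerminal ((Herbrand.nabla P).obj PUnit.{u + 1})) ∧
    Nonempty (IsColimit (BinaryCofan.mk
      ((Herbrand.nabla P).map (↾fun _ : PUnit.{u + 1} => ULift.up.{u} false))
      ((Herbrand.nabla P).map (↾fun _ : PUnit.{u + 1} => ULift.up.{u} true)))) := by
  have hF := Herbrand.nabla_pointDetermined (P := P)
  have := hF.preservesFiniteLimits
  refine ⟨hF.preservesLCCPretopos, hF.reflectsLCCPretopos,
    ⟨this, fun S M Γ φ => M.valid_map_iff hF φ⟩,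
    ⟨IsTerminal.isTerminalObj _ _ Types.isTerminalPUnit⟩,
    ⟨mapIsColimitOfPreservesOfIsColimit _ _ _ (BinaryCofan.IsColimit.mk _
      (fun f g => ↾fun b => if b.down then g PUnit.unit else f PUnit.unit)
      (fun f g => rfl) (fun f g => rfl) fun f g m h1 h2 => ?_)⟩⟩
  ext ⟨b⟩
  cases b
  · exact ConcreteCategory.congr_hom h1 PUnit.unit
  · exact ConcreteCategory.congr_hom h2 PUnit.unit
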